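/- **Definitions.** For $0<a\le b$, let $\mathcal U_{(a,b)}$ be the class of functions $u:\mathbb R\to\mathbb R$ with $u(0)=0$ that are non-decreasing, $b$-Lipschitz, and satisfy $u(z)-u(z')\ge a(z-z')$ for all $z\ge z'\ge 0$. For $L,R>0$, a distribution on $\mathbb R^d$ is $(L,R)$-well-behaved if for $k\in\{1,2\}$ and every orthonormal system $e_1,\dots,e_k$ of $\mathbb R^d$, the vector $(e_i\cdot \mathbf x)_{i\le k}$ has a density $\gamma$ on $\mathbb R^k$ with $\gamma(\mathbf z)\ge L$ whenever $\|\mathbf z\|_\infty\le R$ and $\gamma(\mathbf z)\le \frac1L e^{-L\|\mathbf z\|_2}$ for all $\mathbf z$. Write $\mathcal B(W)$ for the closed Euclidean ball of radius $W$ centered at the origin of $\mathbb R^d$. **Setting.** Let $0<a\le b$, $L,R>0$, $W\ge 1$, $\varepsilon,\delta\in(0,1)$, and let $d$ satisfy $d\ge 2\varepsilon\delta$ and $d\ge1$ (the first condition is automatic for $d\ge 2$). Let $\mathcal D$ be a probability distribution of $(\mathbf x,y)\in\mathbb R^d\times\mathbb R$ whose $\mathbf x$-marginal $\mathcal D_{\mathbf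 x}$ is $(L,R)$-well-behaved with $\mathbb E[\mathbf x\mathbf x^\top]\preccurlyeq \mathbf I$, and whose labels satisfy $|y|\le \frac{bW}{L}\log\!\big(\frac{16b^4W^4}{\varepsilon^2}\big)$ almost surely. Let $$\mathrm{OPT}=\inf_{\|\mathbf w\|_2\le W,\ u\in\mathcal U_{(a,b)}}\mathbb E_{(\mathbf x,y)\sim\mathcal D}[(u(\mathbf w\cdot\mathbf x)-y)^2],$$ and let $\mathbf w^*\in\mathcal B(W)$, $u^*\in\mathcal U_{(a,b)}$ be any pair attaining it. **Corollary 3.4 (Closeness of Idealized and Attainable Activations).** There is a universal constant $C>0$ such that, in every such setting, for every fixed $\mathbf w\in\mathcal B(W)$ and every integer $$m\ \ge\ C\,d\,\log^4\!\Big(\frac{d}{\varepsilon\delta}\Big)\Big(\frac{b^2W^3}{L^2\varepsilon}\Big)^{3/2},$$ if $(\mathbf x^{(1)},y^{(1)}),\dots,(\mathbf x^{(m)},y^{(m)})$ are i.i.d. samples from $\mathcal D$, then with probability at least $1-\delta$ over the samples, every $$\hat u\in\operatorname*{argmin}_{u\in\mathcal U_{(a,b)}}\frac1m\sum_{i=1}^m\big(u(\mathbf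 w\cdot\mathbf x^{(i)})-y^{(i)}\big)^2$$ satisfies $$\mathbb E_{\mathbf x\sim\mathcal D_{\mathbf x}}\big[(\hat u(\mathbf w\cdot\mathbf x)-u^*(\mathbf w^*\cdot\mathbf x))^2\big]\ \le\ 3\big(\varepsilon+\mathrm{OPT}+b^2\|\mathbf w-\mathbf w^*\|_2^2\big).$$ (If this event is not measurable, the claim means that its complement has outer probability at most $\delta$.) -/

import Mathlib

open MeasureTheory
open scoped RealInnerProductSpace

namespace SIM

/-- Real `d`-dimensional space with the Euclidean norm. -/
abbrev Vec (d : ℕ) : Type := EuclideanSpace ℝ (Fin d)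

/-- The class of `(a, b)`-unbounded activations: `u 0 = 0`, `u` is non-decreasing, `b`-Lipschitz,
and `u z - u z' ≥ a (z - z')` for `z ≥ z' ≥ 0`. -/
def activations (a b : ℝ) : Set (ℝ → ℝ) :=
  {u | u 0 = 0 ∧ Monotone u ∧ (∀ z z' : ℝ, |u z - u z'| ≤ b * |z - z'|) ∧
    ∀ z z' : ℝ, 0 ≤ z' → z' ≤ z → a * (z - z') ≤ u z - u z'}

/-- A distribution `μ` on `ℝ^d` is `(L, R)`-well-behaved if its projection onto every subspace `V`
of dimension `1` or `2` has a density `γ` that is at least `L` on the sup-norm ball of radius `R`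
and at most `(1 / L) exp (-L ‖z‖₂)` everywhere. The subspace is given by an orthonormal basis `e`,
through which it is identified with `ℝ^k`. -/
def WellBehaved {d : ℕ} (L R : ℝ) (μ : Measure (Vec d)) : Prop :=
  ∀ k : ℕ, 1 ≤ k → k ≤ 2 → ∀ e : Fin k → Vec d, Orthonormal ℝ e →
    ∃ γ : Vec k → ℝ, Measurable γ ∧ (∀ z, 0 ≤ γ z) ∧
      μ.map (fun x => (WithLp.toLp 2 (fun i => ⟪e i, x⟫) : Vec k)) =
        (volume : Measure (Vec k)).withDensity (fun z => ENNReal.ofReal (γ z)) ∧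
      (∀ z : Vec k, (∀ i, |z i| ≤ R) → L ≤ γ z) ∧
      (∀ z : Vec k, γ z ≤ 1 / L * Real.exp (-L * ‖z‖))

/-- The normalization `E[x xᵀ] ≼ I`, written as an inequality of quadratic forms. -/
def SecondMomentLeOne {d : ℕ} (μ : Measure (Vec d)) : Prop :=
  ∀ v : Vec d, Integrable (fun x => ⟪v, x⟫ ^ 2) μ ∧ ∫ x, ⟪v, x⟫ ^ 2 ∂μ ≤ ‖v‖ ^ 2

/-- The population squared loss `E[(u(w·x) - y)²]` for `(x, y)` distributed as `D`. -/
noncomputable def popLoss {d : ℕ} (D : Measure (Vec d × ℝ)) (w : Vec d) (u : ℝ → ℝ) : ℝ :=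
  ∫ p, (u ⟪w, p.1⟫ - p.2) ^ 2 ∂D

/-- The best squared loss over weight vectors of norm at most `W` and `(a, b)`-unbounded
activations. -/
noncomputable def opt {d : ℕ} (D : Measure (Vec d × ℝ)) (a b W : ℝ) : ℝ :=
  sInf {l | ∃ w : Vec d, ∃ u : ℝ → ℝ, ‖w‖ ≤ W ∧ u ∈ activations a b ∧ l = popLoss D w u}

/-- The empirical squared loss `(1/m) ∑ (u(w·xᵢ) - yᵢ)²` on the sample `S`. -/
noncomputable def empLoss {d m : ℕ} (S : Fin m → Vec d × ℝ) (w : Vec d) (u : ℝ → ℝ) : ℝ :=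
  (1 / (m : ℝ)) * ∑ i, (u ⟪w, (S i).1⟫ - (S i).2) ^ 2

/-- `u` is a sample-optimal activation for the sample `S` and the weight vector `w`. -/
def IsSampleOptimal {d m : ℕ} (a b : ℝ) (S : Fin m → Vec d × ℝ) (w : Vec d) (u : ℝ → ℝ) : Prop :=
  u ∈ activations a b ∧ ∀ v ∈ activations a b, empLoss S w u ≤ empLoss S w v

/-- The level `(bW/L) log(16 b⁴ W⁴ / ε²)` at which labels are truncated. -/
noncomputable def labelBound (b W L ε : ℝ) : ℝ :=
  b * W / L * Real.log (16 * b ^ 4 * W ^ 4 / ε ^ 2)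

end SIM

namespace SIM

/-! Fix `w`, and let f(x) = u*(w*·x) be the target. The activation class is convex, so a
sample-optimal û is an empirical L² projection of the labels. Its obtuse-angle condition, tested
against the competitor u*(w·x), gives, deterministically on every sample, mean (û(w·x) - f)² ≤ mean
[(f - y)² + (u*(w·x) - f)²] (`IsSampleOptimal.empMean_sq_le`). The expectation of the right side is
at most OPT + b²‖w - w*‖², by optimality of (w*, u*), the Lipschitz property and E[xxᵀ] ≼ I.

Two concentration statements, each failing with probability at most δ/2, connect samples and
expectations. The random û requires a bound uniform over the class: E ≤ 2·mean + ρ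
(`measure_pi_uniform_sq_le`). The right side is one fixed function and needs only mean ≤ (3/2)·E + ρ
(`measure_pi_empMean_upper_of_exp`). The factors 2 and 3/2 multiply to the 3 of the conclusion, and
the errors add up to 2ρ + ρ = 3ρ.

Everything is multiplied by c = L/(4bW), with ρ = c²ε. Activations become 1-Lipschitz functions of
one real variable, and all values are dominated by an envelope r with E[exp r] ≤ 4, an absolute
constant.

For the uniform bound, cut the space into shells k ≤ r < k + 1. On a shell the class is bounded and
has a uniform cover at scale s whose log-cardinality is of order (k + 1)/s. Since the shell has mass
O(exp(-k)), s may grow like √ρ·exp(k/2), up to polynomial factors. The cover costs about 1/√ρ and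
the multiplicative Chernoff bound another 1/ρ, whence the exponent 3/2 in the sample size. -/

/-- The empirical mean of `f` over the sample `S`. -/
noncomputable def empMean {X : Type*} {m : ℕ} (S : Fin m → X) (f : X → ℝ) : ℝ :=
  (1 / (m : ℝ)) * ∑ i, f (S i)

/-! ### Chernoff and Markov bounds for empirical means -/

section Concentration

variable {X : Type*} [MeasurableSpace X] {μ : Measure X} [IsProbabilityMeasure μ]

/-- The exponential Markov inequality for a sum of independent copies. -/
theorem measure_pi_le_sum_le {f : X → ℝ} {v : ℝ}
    (hi : Integrable (fun x => Real.exp (f x)) μ) (h : ∫ x, Real.exp (f x) ∂μ ≤ Real.exp v)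
    (m : ℕ) (t : ℝ) :
    Measure.pi (fun _ : Fin m => μ) {S | t ≤ ∑ i, f (S i)} ≤
      ENNReal.ofReal (Real.exp (m * v - t)) := by
  have hint : Integrable (fun S : Fin m → X => ∏ i, Real.exp (f (S i)))
      (Measure.pi (fun _ : Fin m => μ)) := Integrable.fintype_prod (fun _ => hi)
  have hM := mul_meas_ge_le_integral_of_nonneg
    (Filter.Eventually.of_forall fun S => Finset.prod_nonneg fun i _ => (Real.exp_pos _).le)
    hint (Real.exp t)
  rw [integral_fintype_prod_eq_pow (fun x => Real.exp (f x)), Fintype.card_fin] at hM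
  have hset : {S : Fin m → X | Real.exp t ≤ ∏ i, Real.exp (f (S i))} =
      {S | t ≤ ∑ i, f (S i)} := by
    ext S
    simp [← Real.exp_sum]
  rw [hset] at hM
  have hp : (∫ x, Real.exp (f x) ∂μ) ^ m ≤ Real.exp (m * v) := by
    rw [Real.exp_nat_mul]
    exact pow_le_pow_left₀ (integral_nonneg fun x => (Real.exp_pos _).le) h m
  rw [← ofReal_measureReal]
  refine ENNReal.ofReal_le_ofReal ?_
  rw [Real.exp_sub, le_div_iff₀ (Real.exp_pos t), mul_comm]
  exact hM.trans hp

/-- An affine majorant of the exponential on [0, 1] bounds the moment generating function by the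
mean alone, with no variance term. The ratio κ / c becomes the multiplicative factor (3/4 or 3/2) of
the tail bounds below. -/
theorem integral_exp_smul_le {Z : X → ℝ} (hZ : Measurable Z) (h0 : ∀ x, 0 ≤ Z x) {M : ℝ}
    (hM : 0 < M) (hZM : ∀ x, Z x ≤ M) {c κ : ℝ}
    (hc : ∀ y, 0 ≤ y → y ≤ 1 → Real.exp (c * y) ≤ 1 + κ * y) :
    Integrable (fun x => Real.exp (c / M * Z x)) μ ∧
      ∫ x, Real.exp (c / M * Z x) ∂μ ≤ Real.exp (κ / M * ∫ x, Z x ∂μ) := by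
  have hZi : Integrable Z μ := Integrable.of_bound hZ.aestronglyMeasurable M
    (Filter.Eventually.of_forall fun x => by rw [Real.norm_of_nonneg (h0 x)]; exact hZM x)
  have hpt : ∀ x, Real.exp (c / M * Z x) ≤ 1 + κ / M * Z x := fun x => by
    have := hc (Z x / M) (div_nonneg (h0 x) hM.le) ((div_le_one hM).2 (hZM x))
    calc Real.exp (c / M * Z x) = Real.exp (c * (Z x / M)) := by ring_nf
      _ ≤ _ := this
      _ = _ := by ring
  have hub : Integrable (fun x => 1 + κ / M * Z x) μ :=
    (integrable_const _).add (hZi.const_mul _)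
  have hi : Integrable (fun x => Real.exp (c / M * Z x)) μ :=
    hub.mono' (by fun_prop) (Filter.Eventually.of_forall fun x => by
      rw [Real.norm_of_nonneg (Real.exp_pos _).le]; exact hpt x)
  refine ⟨hi, (integral_mono hi hub hpt).trans ?_⟩
  rw [integral_add (integrable_const _) (hZi.const_mul _), integral_const_mul]
  simp only [integral_const, probReal_univ, smul_eq_mul, mul_one]
  linarith [Real.add_one_le_exp (κ / M * ∫ x, Z x ∂μ)]

/-- Multiplicative lower tail bound for the empirical mean of a bounded nonnegative function. -/
theorem measure_pi_empMean_lower {Z : X → ℝ} (hZ : Measurable Z) (h0 : ∀ x, 0 ≤ Z x) {M : ℝ}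
    (hM : 0 < M) (hZM : ∀ x, Z x ≤ M) {m : ℕ} (hm : 0 < m) (t : ℝ) :
    Measure.pi (fun _ : Fin m => μ) {S | empMean S Z < 3 / 4 * ∫ x, Z x ∂μ - t} ≤
      ENNReal.ofReal (Real.exp (-(m * t / (4 * M)))) := by
  have hc : ∀ y : ℝ, 0 ≤ y → y ≤ 1 → Real.exp (-1 / 4 * y) ≤ 1 + -3 / 16 * y := by
    intro y hy0 hy1
    have h1 := Real.abs_exp_sub_one_sub_id_le (x := -1 / 4 * y)
      (by rw [abs_le]; constructor <;> linarith)
    have h2 := (abs_le.1 h1).2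
    nlinarith
  obtain ⟨hi, hle⟩ := integral_exp_smul_le (μ := μ) hZ h0 hM hZM hc
  have hm' : (0 : ℝ) < m := by exact_mod_cast hm
  refine (measure_mono ?_).trans ((measure_pi_le_sum_le hi hle m
    (-1 / 4 / M * (m * (3 / 4 * ∫ x, Z x ∂μ - t)))).trans
    (ENNReal.ofReal_le_ofReal (Real.exp_le_exp.2 (le_of_eq ?_))))
  · intro S hS
    simp only [Set.mem_ofPred_eq, empMean] at hS ⊢
    rw [one_div, inv_mul_lt_iff₀ hm'] at hS
    rw [← Finset.mul_sum]
    exact mul_le_mul_of_nonpos_left hS.le (div_nonpos_of_nonpos_of_nonneg (by norm_num) hM.le)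
  · field_simp
    ring

/-- Multiplicative upper tail bound for the empirical mean of a bounded nonnegative function. -/
theorem measure_pi_empMean_upper {Z : X → ℝ} (hZ : Measurable Z) (h0 : ∀ x, 0 ≤ Z x) {M : ℝ}
    (hM : 0 < M) (hZM : ∀ x, Z x ≤ M) {m : ℕ} (hm : 0 < m) (t : ℝ) :
    Measure.pi (fun _ : Fin m => μ) {S | 3 / 2 * ∫ x, Z x ∂μ + t < empMean S Z} ≤
      ENNReal.ofReal (Real.exp (-(m * t / (2 * M)))) := by
  have hc : ∀ y : ℝ, 0 ≤ y → y ≤ 1 → Real.exp (1 / 2 * y) ≤ 1 + 3 / 4 * y := by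
    intro y hy0 hy1
    have h1 := Real.abs_exp_sub_one_sub_id_le (x := 1 / 2 * y)
      (by rw [abs_le]; constructor <;> linarith)
    have h2 := (abs_le.1 h1).2
    nlinarith
  obtain ⟨hi, hle⟩ := integral_exp_smul_le (μ := μ) hZ h0 hM hZM hc
  have hm' : (0 : ℝ) < m := by exact_mod_cast hm
  refine (measure_mono ?_).trans ((measure_pi_le_sum_le hi hle m
    (1 / 2 / M * (m * (3 / 2 * ∫ x, Z x ∂μ + t)))).trans
    (ENNReal.ofReal_le_ofReal (Real.exp_le_exp.2 (le_of_eq ?_))))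
  · intro S hS
    simp only [Set.mem_ofPred_eq, empMean] at hS ⊢
    rw [one_div, lt_inv_mul_iff₀ hm'] at hS
    rw [← Finset.mul_sum]
    exact mul_le_mul_of_nonneg_left hS.le (div_nonneg (by norm_num) hM.le)
  · field_simp
    ring

/-- Markov's inequality for the empirical mean of a nonnegative function. -/
theorem measure_pi_le_empMean {Z : X → ℝ} (hZ : Integrable Z μ) (h0 : ∀ x, 0 ≤ Z x) {m : ℕ}
    (hm : 0 < m) {t : ℝ} (ht : 0 < t) :
    Measure.pi (fun _ : Fin m => μ) {S | t ≤ empMean S Z} ≤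
      ENNReal.ofReal ((∫ x, Z x ∂μ) / t) := by
  have hm' : (0 : ℝ) < m := by exact_mod_cast hm
  have hev : ∀ i : Fin m, Integrable (fun S : Fin m → X => Z (S i))
      (Measure.pi (fun _ : Fin m => μ)) := fun i =>
    (measurePreserving_eval (fun _ : Fin m => μ) i).integrable_comp_of_integrable hZ
  have hint : Integrable (fun S : Fin m → X => empMean S Z)
      (Measure.pi (fun _ : Fin m => μ)) :=
    (integrable_finsetSum _ fun i _ => hev i).const_mul _
  have hmean : ∫ S : Fin m → X, empMean S Z ∂(Measure.pi (fun _ : Fin m => μ)) =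
      ∫ x, Z x ∂μ := by
    unfold empMean
    rw [integral_const_mul, integral_finsetSum _ fun i _ => hev i]
    have : ∀ i : Fin m, ∫ S : Fin m → X, Z (S i) ∂(Measure.pi (fun _ : Fin m => μ)) =
        ∫ x, Z x ∂μ := fun i => by
      have hmp := measurePreserving_eval (fun _ : Fin m => μ) i
      have := integral_map (μ := Measure.pi (fun _ : Fin m => μ)) hmp.measurable.aemeasurable
        (f := Z) (by rw [hmp.map_eq]; exact hZ.aestronglyMeasurable)
      rw [hmp.map_eq] at this
      exact this.symm
    simp only [this, Finset.sum_const, Finset.card_univ, Fintype.card_fin, nsmul_eq_mul]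
    field_simp
  have hM : t * (Measure.pi (fun _ : Fin m => μ)).real {S | t ≤ empMean S Z} ≤
      ∫ S : Fin m → X, empMean S Z ∂(Measure.pi (fun _ : Fin m => μ)) :=
    mul_meas_ge_le_integral_of_nonneg
    (Filter.Eventually.of_forall fun S : Fin m → X =>
      (mul_nonneg (by positivity) (Finset.sum_nonneg fun i _ => h0 _) : 0 ≤ empMean S Z))
    hint t
  rw [hmean] at hM
  rw [← ofReal_measureReal]
  refine ENNReal.ofReal_le_ofReal ?_
  rwa [le_div_iff₀ ht, mul_comm]

end Concentration

/-! ### Covers of monotone 1-Lipschitz functions -/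

section Cover

/-- Non-decreasing `1`-Lipschitz functions vanishing at the origin. -/
def unitActivations : Set (ℝ → ℝ) :=
  {φ | φ 0 = 0 ∧ Monotone φ ∧ ∀ x y : ℝ, |φ x - φ y| ≤ |x - y|}

theorem abs_le_of_mem_unitActivations {φ : ℝ → ℝ} (hφ : φ ∈ unitActivations) (x : ℝ) :
    |φ x| ≤ |x| := by
  simpa [hφ.1] using hφ.2.2 x 0

theorem continuous_of_mem_unitActivations {φ : ℝ → ℝ} (hφ : φ ∈ unitActivations) :
    Continuous φ :=
  (LipschitzWith.of_dist_le_mul (K := 1) fun x y => by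
    simpa [Real.dist_eq] using hφ.2.2 x y).continuous

/-- The function `φ` sampled on the grid of mesh `s` and rounded down to that grid. -/
noncomputable def gridLevel (s : ℝ) (φ : ℝ → ℝ) (j : ℕ) : ℕ := ⌊φ (j * s) / s⌋₊

/-- The positions among the first `J` at which the rounded function increases. -/
noncomputable def gridJumps (s : ℝ) (J : ℕ) (φ : ℝ → ℝ) : Finset ℕ :=
  (Finset.range J).filter fun j => gridLevel s φ (j + 1) ≠ gridLevel s φ j

/-- Arguments and values use the same mesh `s`, so a 1-Lipschitz function climbs at most one level
per step. Hence the set of jump positions determines all levels, leaving only 2^J possibilities on a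
half-line. -/
theorem gridLevel_succ {s : ℝ} (hs : 0 < s) {φ : ℝ → ℝ} (hφ : φ ∈ unitActivations) (j : ℕ) :
    gridLevel s φ (j + 1) = gridLevel s φ j ∨ gridLevel s φ (j + 1) = gridLevel s φ j + 1 := by
  have hmono : φ (j * s) ≤ φ ((j + 1 : ℕ) * s) := hφ.2.1 (by push_cast; nlinarith)
  have hlip := (abs_le.1 (hφ.2.2 ((j + 1 : ℕ) * s) (j * s))).2
  have habs : |((j + 1 : ℕ) : ℝ) * s - j * s| = s := by
    push_cast
    rw [show ((j : ℝ) + 1) * s - j * s = s by ring, abs_of_pos hs]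
  rw [habs] at hlip
  have h0 : 0 ≤ φ (j * s) := by
    rw [← hφ.1]
    exact hφ.2.1 (by positivity)
  have h1 : gridLevel s φ j ≤ gridLevel s φ (j + 1) :=
    Nat.floor_mono (div_le_div_of_nonneg_right hmono hs.le)
  have h2 : gridLevel s φ (j + 1) ≤ gridLevel s φ j + 1 := by
    unfold gridLevel
    rw [← Nat.floor_add_one (div_nonneg h0 hs.le)]
    refine Nat.floor_mono ?_
    rw [div_add_one hs.ne']
    exact div_le_div_of_nonneg_right (by linarith) hs.le
  omega

theorem gridLevel_eq {s : ℝ} (hs : 0 < s) {J : ℕ} {φ ψ : ℝ → ℝ} (hφ : φ ∈ unitActivations)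
    (hψ : ψ ∈ unitActivations) (h : gridJumps s J φ = gridJumps s J ψ) {j : ℕ} (hj : j ≤ J) :
    gridLevel s φ j = gridLevel s ψ j := by
  induction j with
  | zero => simp [gridLevel, hφ.1, hψ.1]
  | succ j ih =>
    have ih := ih (by omega)
    have hmem : j ∈ gridJumps s J φ ↔ j ∈ gridJumps s J ψ := by rw [h]
    simp only [gridJumps, Finset.mem_filter, Finset.mem_range] at hmem
    have h1 := gridLevel_succ hs hφ j
    have h2 := gridLevel_succ hs hψ j
    have : j < J := by omega
    simp only [this, true_and] at hmem
    omega

/-- Rounding down loses at most `s`, and moving from the grid point to `x` adds at most `s`. Both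
values therefore lie in the same interval of length 2s above the common level. -/
theorem abs_sub_le_of_gridJumps_eq {s : ℝ} (hs : 0 < s) {J : ℕ} {φ ψ : ℝ → ℝ}
    (hφ : φ ∈ unitActivations) (hψ : ψ ∈ unitActivations)
    (h : gridJumps s J φ = gridJumps s J ψ) {x : ℝ} (hx0 : 0 ≤ x) (hx : x ≤ J * s) :
    |φ x - ψ x| ≤ 2 * s := by
  set j := ⌊x / s⌋₊ with hj
  have hjJ : j ≤ J := by
    have : x / s ≤ J := by rwa [div_le_iff₀ hs]
    exact (Nat.floor_mono this).trans (by simp)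
  have hj1 : j * s ≤ x := by
    rw [← le_div_iff₀ hs]
    exact Nat.floor_le (by positivity)
  have hj2 : x ≤ (j + 1) * s := by
    rw [← div_le_iff₀ hs]
    exact (Nat.lt_floor_add_one _).le
  have key : ∀ χ ∈ unitActivations, (gridLevel s χ j : ℝ) * s ≤ χ x ∧
      χ x ≤ (gridLevel s χ j + 2) * s := by
    intro χ hχ
    have h0 : 0 ≤ χ (j * s) := by
      rw [← hχ.1]
      exact hχ.2.1 (by positivity)
    have hf1 : (gridLevel s χ j : ℝ) * s ≤ χ (j * s) := by
      rw [← le_div_iff₀ hs]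
      exact Nat.floor_le (by positivity)
    have hf2 : χ (j * s) ≤ (gridLevel s χ j + 1) * s := by
      rw [← div_le_iff₀ hs]
      exact (Nat.lt_floor_add_one _).le
    have hm := hχ.2.1 hj1
    have hl := (abs_le.1 (hχ.2.2 x (j * s))).2
    rw [abs_of_nonneg (by linarith)] at hl
    constructor <;> linarith
  have e := gridLevel_eq hs hφ hψ h hjJ
  have h1 := key φ hφ
  have h2 := key ψ hψ
  rw [e] at h1
  rw [abs_le]
  constructor <;> linarith [h1.1, h1.2, h2.1, h2.2]

theorem neg_comp_neg_mem_unitActivations {φ : ℝ → ℝ} (hφ : φ ∈ unitActivations) :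
    (fun x => -φ (-x)) ∈ unitActivations := by
  refine ⟨by simp [hφ.1], fun x y hxy => neg_le_neg (hφ.2.1 (neg_le_neg hxy)), fun x y => ?_⟩
  have := hφ.2.2 (-y) (-x)
  rwa [show -φ (-x) - -φ (-y) = φ (-y) - φ (-x) by ring,
    show x - y = -y - -x by ring]

/-- A finite uniform cover of the class `unitActivations` on a bounded interval. -/
theorem exists_cover_unitActivations {s : ℝ} (hs : 0 < s) (J : ℕ) :
    ∃ G : Finset (ℝ → ℝ), (G.card : ℝ) ≤ 4 ^ J ∧ (∀ ψ ∈ G, ψ ∈ unitActivations) ∧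
      ∀ φ ∈ unitActivations, ∃ ψ ∈ G, ∀ x, |x| ≤ J * s → |φ x - ψ x| ≤ 2 * s := by
  classical
  -- The negative half-line is encoded by reflecting the function through the origin; the two codes
  -- together give 2^J · 2^J = 4^J.
  let code : (ℝ → ℝ) → Finset ℕ × Finset ℕ := fun φ =>
    (gridJumps s J φ, gridJumps s J fun x => -φ (-x))
  let T : Finset (Finset ℕ × Finset ℕ) :=
    (Finset.range J).powerset ×ˢ (Finset.range J).powerset
  have hT : ∀ φ, code φ ∈ T := fun φ => by
    simp only [T, code, Finset.mem_product, Finset.mem_powerset]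
    exact ⟨Finset.filter_subset _ _, Finset.filter_subset _ _⟩
  -- For unattained codes the default is the identity, so that every representative lies in the
  -- class.
  let rep : Finset ℕ × Finset ℕ → (ℝ → ℝ) := fun c =>
    if h : ∃ φ ∈ unitActivations, code φ = c then h.choose else fun x => x
  have hrep : ∀ c, rep c ∈ unitActivations := fun c => by
    by_cases h : ∃ φ ∈ unitActivations, code φ = c
    · simp only [rep, dif_pos h]
      exact h.choose_spec.1
    · simp only [rep, dif_neg h]
      exact ⟨rfl, monotone_id, fun x y => le_rfl⟩
  refine ⟨T.image rep, ?_, ?_, ?_⟩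
  · have : (T.image rep).card ≤ 4 ^ J := by
      refine Finset.card_image_le.trans ?_
      simp only [T, Finset.card_product, Finset.card_powerset, Finset.card_range]
      rw [← mul_pow]
      norm_num
    exact_mod_cast this
  · intro ψ hψ
    obtain ⟨c, -, rfl⟩ := Finset.mem_image.1 hψ
    exact hrep c
  · intro φ hφ
    refine ⟨rep (code φ), Finset.mem_image_of_mem _ (hT φ), fun x hx => ?_⟩
    have hex : ∃ χ ∈ unitActivations, code χ = code φ := ⟨φ, hφ, rfl⟩
    have hc : code (rep (code φ)) = code φ := by
      simp only [rep, dif_pos hex]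
      exact hex.choose_spec.2
    have hc1 := congrArg Prod.fst hc
    have hc2 := congrArg Prod.snd hc
    rcases le_total 0 x with h0 | h0
    · rw [abs_of_nonneg h0] at hx
      exact abs_sub_le_of_gridJumps_eq hs hφ (hrep _) hc1.symm h0 hx
    · rw [abs_of_nonpos h0] at hx
      have := abs_sub_le_of_gridJumps_eq hs (neg_comp_neg_mem_unitActivations hφ)
        (neg_comp_neg_mem_unitActivations (hrep _)) hc2.symm (neg_nonneg.2 h0) hx
      rw [abs_sub_comm]
      simpa [neg_add_eq_sub] using this

end Cover

/-! ### Uniform lower bound on a bounded region -/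

theorem empMean_mono {X : Type*} {m : ℕ} (S : Fin m → X) {f g : X → ℝ} (h : ∀ x, f x ≤ g x) :
    empMean S f ≤ empMean S g :=
  mul_le_mul_of_nonneg_left (Finset.sum_le_sum fun i _ => h (S i)) (by positivity)

/-- When a ≥ 4s, the difference of the two sides is the square (a - 16s)² / 4. -/
theorem sq_posPart_sub_ge {a s : ℝ} (ha : 0 ≤ a) :
    3 / 4 * a ^ 2 - 48 * s ^ 2 ≤ max (a - 4 * s) 0 ^ 2 := by
  rcases le_total (a - 4 * s) 0 with h | h
  · rw [max_eq_right h]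
    nlinarith
  · rw [max_eq_left h]
    nlinarith [sq_nonneg (a - 16 * s)]

section Uniform

variable {X : Type*} [MeasurableSpace X] {μ : Measure X} [IsProbabilityMeasure μ]

/-- Uniform lower bound for empirical squared distances on a bounded region. -/
theorem measure_pi_setIntegral_sq_lower {z F : X → ℝ} (hz : Measurable z) (hF : Measurable F)
    {A : Set X} (hA : MeasurableSet A) {T : ℝ} (hT : 0 < T) (hzA : ∀ x ∈ A, |z x| ≤ T)
    (hFA : ∀ x ∈ A, |F x| ≤ T) {s : ℝ} (hs : 0 < s) {J : ℕ} (hJ : T ≤ J * s) {m : ℕ}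
    (hm : 0 < m) (t : ℝ) :
    Measure.pi (fun _ : Fin m => μ) {S | ∃ φ ∈ unitActivations,
      empMean S (A.indicator fun x => (φ (z x) - F x) ^ 2) <
        9 / 16 * ∫ x in A, (φ (z x) - F x) ^ 2 ∂μ - 36 * s ^ 2 * μ.real A - t} ≤
      ENNReal.ofReal (4 ^ J * Real.exp (-(m * t / (16 * T ^ 2)))) := by
  obtain ⟨G, hGc, hG, hcov⟩ := exists_cover_unitActivations hs J
  -- Shrinking the distance by 2s puts `Z ψ` below (φ - F)² for every φ within 2s of ψ, yet above
  -- (|φ - F| - 4s)₊². So the one-sided bound for ψ transfers to φ, with factor 3/4 · 3/4 = 9/16 and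
  -- error 3/4 · 48s² = 36s².
  let Z : (ℝ → ℝ) → X → ℝ := fun ψ =>
    A.indicator fun x => max (|ψ (z x) - F x| - 2 * s) 0 ^ 2
  have hZm : ∀ ψ ∈ G, Measurable (Z ψ) := fun ψ hψ => by
    have := (continuous_of_mem_unitActivations (hG ψ hψ)).measurable.comp hz
    refine Measurable.indicator ?_ hA
    have h1 : Measurable fun x => |ψ (z x) - F x| := (this.sub hF).abs
    exact ((h1.sub_const _).max measurable_const).pow_const 2
  have hZ0 : ∀ ψ x, 0 ≤ Z ψ x := fun ψ x => Set.indicator_nonneg (fun x _ => sq_nonneg _) x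
  have hbd : ∀ ψ ∈ unitActivations, ∀ x ∈ A, |ψ (z x) - F x| ≤ 2 * T := fun ψ hψ x hx => by
    have h1 := abs_sub (ψ (z x)) (F x)
    have h2 := abs_le_of_mem_unitActivations hψ (z x)
    linarith [hzA x hx, hFA x hx]
  have hZM : ∀ ψ ∈ G, ∀ x, Z ψ x ≤ 4 * T ^ 2 := fun ψ hψ x => by
    refine Set.indicator_apply_le' (fun hx => ?_) fun _ => by positivity
    have h1 : max (|ψ (z x) - F x| - 2 * s) 0 ≤ 2 * T :=
      max_le (by linarith [hbd ψ (hG ψ hψ) x hx]) (by positivity)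
    nlinarith [le_max_right (|ψ (z x) - F x| - 2 * s) 0]
  have hsub : {S : Fin m → X | ∃ φ ∈ unitActivations,
      empMean S (A.indicator fun x => (φ (z x) - F x) ^ 2) <
        9 / 16 * ∫ x in A, (φ (z x) - F x) ^ 2 ∂μ - 36 * s ^ 2 * μ.real A - t} ⊆
      ⋃ ψ ∈ G, {S | empMean S (Z ψ) < 3 / 4 * ∫ x, Z ψ x ∂μ - t} := by
    rintro S ⟨φ, hφ, hS⟩
    obtain ⟨ψ, hψ, hclose⟩ := hcov φ hφ
    refine Set.mem_biUnion hψ ?_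
    have hd : ∀ x ∈ A, |φ (z x) - ψ (z x)| ≤ 2 * s := fun x hx =>
      hclose _ ((hzA x hx).trans hJ)
    have hle : ∀ x, Z ψ x ≤ A.indicator (fun x => (φ (z x) - F x) ^ 2) x := by
      refine fun x => Set.indicator_le_indicator' fun hx => ?_
      rw [← sq_abs (φ (z x) - F x)]
      refine pow_le_pow_left₀ (le_max_right _ _) (max_le ?_ (abs_nonneg _)) 2
      have h1 := abs_sub_abs_le_abs_sub (ψ (z x) - F x) (φ (z x) - F x)
      rw [sub_sub_sub_cancel_right, abs_sub_comm (ψ (z x)) (φ (z x))] at h1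
      linarith [hd x hx]
    have hZint : ∫ x, Z ψ x ∂μ =
        ∫ x in A, max (|ψ (z x) - F x| - 2 * s) 0 ^ 2 ∂μ := integral_indicator hA
    have hgei : 3 / 4 * ∫ x in A, (φ (z x) - F x) ^ 2 ∂μ - 48 * s ^ 2 * μ.real A ≤
        ∫ x, Z ψ x ∂μ := by
      have hφm := (continuous_of_mem_unitActivations hφ).measurable.comp hz
      have hi1 : IntegrableOn (fun x => (φ (z x) - F x) ^ 2) A μ := by
        refine IntegrableOn.of_bound (measure_lt_top _ _)
          ((hφm.sub hF).pow_const 2).aestronglyMeasurable ((2 * T) ^ 2)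
          ((ae_restrict_iff' hA).2 (Filter.Eventually.of_forall fun x hx => ?_))
        rw [Real.norm_of_nonneg (sq_nonneg _), ← sq_abs]
        exact pow_le_pow_left₀ (abs_nonneg _) (hbd φ hφ x hx) 2
      have hi2 : IntegrableOn (fun x => max (|ψ (z x) - F x| - 2 * s) 0 ^ 2) A μ := by
        have : Integrable (Z ψ) μ := Integrable.of_bound (hZm ψ hψ).aestronglyMeasurable
          (4 * T ^ 2) (Filter.Eventually.of_forall fun x => by
            rw [Real.norm_of_nonneg (hZ0 ψ x)]; exact hZM ψ hψ x)
        exact (integrable_indicator_iff hA).1 this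
      have hc : ∫ _ in A, 48 * s ^ 2 ∂μ = 48 * s ^ 2 * μ.real A := by
        rw [setIntegral_const, smul_eq_mul, mul_comm]
      have hci : IntegrableOn (fun _ : X => 48 * s ^ 2) A μ :=
        integrableOn_const (measure_ne_top _ _)
      rw [hZint, ← hc, ← integral_const_mul, ← integral_sub (hi1.const_mul _) hci]
      refine setIntegral_mono_on ((hi1.const_mul _).sub hci) hi2 hA fun x hx => ?_
      rw [← sq_abs (φ (z x) - F x)]
      refine (sq_posPart_sub_ge (abs_nonneg _)).trans
        (pow_le_pow_left₀ (le_max_right _ _) (max_le_max ?_ le_rfl) 2)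
      have h1 := abs_sub_abs_le_abs_sub (φ (z x) - F x) (ψ (z x) - F x)
      rw [sub_sub_sub_cancel_right] at h1
      linarith [hd x hx]
    have := empMean_mono S hle
    simp only [Set.mem_ofPred_eq]
    linarith
  refine (measure_mono hsub).trans ((measure_biUnion_finset_le _ _).trans
    ((Finset.sum_le_sum fun ψ hψ => measure_pi_empMean_lower (hZm ψ hψ) (hZ0 ψ)
      (by positivity : 0 < 4 * T ^ 2) (hZM ψ hψ) hm t).trans ?_))
  rw [Finset.sum_const, nsmul_eq_mul, ← ENNReal.ofReal_natCast,
    ← ENNReal.ofReal_mul (Nat.cast_nonneg _)]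
  refine ENNReal.ofReal_le_ofReal ?_
  rw [show 4 * (4 * T ^ 2) = 16 * T ^ 2 by ring]
  exact mul_le_mul_of_nonneg_right hGc (Real.exp_pos _).le

end Uniform

/-! ### Shells of the envelope and the uniform bound -/

/-- Chooses the scale of the cover on shell k. The conclusions say that the grid reaches radius k +
1, that the discretisation error weighted by the shell's mass fits its budget, and that the Chernoff
exponent beats the log-cardinality of the cover plus the cost of the failure probability. -/
theorem exists_grid_of_large_sample {ρ l M : ℝ} (hρ : 0 < ρ) (hl : 0 ≤ l) {k : ℕ}
    (hk : ρ < 32 * ((k : ℝ) + 1) ^ 4 * Real.exp (-k))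
    (hM : 2000000000 * (1 + l) ≤ M * √ρ ^ 3) :
    ∃ (s : ℝ) (J : ℕ), 0 < s ∧ (k : ℝ) + 1 ≤ J * s ∧
      288 * s ^ 2 * Real.exp (-k) ≤ ρ / (4 * ((k : ℝ) + 1) ^ 2) ∧
      2 * J + ((k : ℝ) + 1) + l ≤ M * ρ / (128 * ((k : ℝ) + 1) ^ 4) := by
  set n : ℝ := (k : ℝ) + 1 with hn
  have hn1 : 1 ≤ n := by simp [hn]
  set p := √ρ with hp
  have hp0 : 0 < p := Real.sqrt_pos.2 hρ
  have hpp : p ^ 2 = ρ := Real.sq_sqrt hρ.le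
  set q := Real.exp (k / 2) with hq
  have hq0 : 0 < q := Real.exp_pos _
  have hqq : q ^ 2 * Real.exp (-k) = 1 := by
    rw [hq, ← Real.exp_nat_mul, ← Real.exp_add]
    simp only [Real.exp_eq_one_iff]
    push_cast
    ring
  have hqn : Real.exp n = Real.exp 1 * q ^ 2 := by
    rw [hq, ← Real.exp_nat_mul, ← Real.exp_add]
    congr 1
    push_cast
    rw [hn]
    ring
  have he := Real.exp_one_lt_d9
  -- The exponential growth of the mesh pays for the polynomial factors in the cover size; 92160 = 2
  -- · 2⁶ · 6!.
  have h6 : n ^ 6 ≤ 92160 * q := by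
    have h1 := Real.pow_div_factorial_le_exp (n / 2) (by positivity) 6
    have h2 : Real.exp (n / 2) = Real.exp (1 / 2) * q := by
      rw [hq, ← Real.exp_add, hn]
      ring_nf
    have h3 : Real.exp (1 / 2) ≤ 2 := by
      have : Real.exp (1 / 2) ^ 2 = Real.exp 1 := by
        rw [← Real.exp_nat_mul]
        norm_num
      nlinarith [Real.exp_pos (1 / 2)]
    rw [h2] at h1
    norm_num [Nat.factorial] at h1
    have h4 : Real.exp (1 / 2) * q ≤ 2 * q := mul_le_mul_of_nonneg_right h3 hq0.le
    norm_num at h4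
    have h5 : (n / 2) ^ 6 = n ^ 6 / 64 := by ring
    rw [h5] at h1
    linarith
  -- The hypothesis `hk` restricts to shells with k at most logarithmic in 1/ρ. This controls the
  -- terms of the exponent that do not shrink with `s`.
  have h10 : p * n ^ 5 ≤ 3000000 := by
    have h1 := Real.pow_div_factorial_le_exp n (by positivity) 14
    rw [hqn, div_le_iff₀ (by positivity)] at h1
    norm_num [Nat.factorial] at h1
    have h2 : p ^ 2 * q ^ 2 ≤ 32 * n ^ 4 := by
      rw [hpp]
      have := mul_le_mul_of_nonneg_right hk.le (sq_nonneg q)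
      rwa [mul_assoc (32 * n ^ 4), mul_comm (Real.exp _), hqq, mul_one] at this
    have h3 : n ^ 14 ≤ 3 * 87178291200 * q ^ 2 := by
      nlinarith [sq_nonneg q]
    have h4 : (p * n ^ 5) ^ 2 * n ^ 4 ≤ 3000000 ^ 2 * n ^ 4 := by
      calc (p * n ^ 5) ^ 2 * n ^ 4 = p ^ 2 * n ^ 14 := by ring
        _ ≤ p ^ 2 * (3 * 87178291200 * q ^ 2) := mul_le_mul_of_nonneg_left h3 (sq_nonneg p)
        _ = 3 * 87178291200 * (p ^ 2 * q ^ 2) := by ring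
        _ ≤ 3 * 87178291200 * (32 * n ^ 4) := mul_le_mul_of_nonneg_left h2 (by norm_num)
        _ ≤ 3000000 ^ 2 * n ^ 4 := by nlinarith [pow_pos (by linarith : 0 < n) 4]
    exact le_of_sq_le_sq (le_of_mul_le_mul_right h4 (by positivity)) (by norm_num)
  have h9 : p * n ^ 4 ≤ 3000000 := by
    refine le_trans (mul_le_mul_of_nonneg_left ?_ hp0.le) h10
    exact pow_le_pow_right₀ hn1 (by norm_num)
  -- The 34 comes from 34² = 1156 ≥ 4 · 288, as the error budget demands.
  refine ⟨p * q / (34 * n), ⌈n / (p * q / (34 * n))⌉₊, by positivity, ?_, ?_, ?_⟩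
  · rw [← div_le_iff₀ (by positivity)]
    exact Nat.le_ceil _
  · have : 288 * (p * q / (34 * n)) ^ 2 * Real.exp (-k) = 288 * ρ / (1156 * n ^ 2) := by
      calc _ = 288 * p ^ 2 * (q ^ 2 * Real.exp (-k)) / (1156 * n ^ 2) := by
            field_simp
            ring
        _ = _ := by rw [hqq, hpp, mul_one]
    rw [this, div_le_div_iff₀ (by positivity) (by positivity)]
    nlinarith [mul_pos hρ (pow_pos (by linarith : 0 < n) 2)]
  · have hJ := (Nat.ceil_lt_add_one (a := n / (p * q / (34 * n))) (by positivity)).le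
    set J : ℝ := (⌈n / (p * q / (34 * n))⌉₊ : ℝ)
    have hJ' : p * n ^ 4 * J ≤ 34 * 92160 + 3000000 := by
      calc p * n ^ 4 * J ≤ p * n ^ 4 * (n / (p * q / (34 * n)) + 1) :=
            mul_le_mul_of_nonneg_left hJ (by positivity)
        _ = 34 * (n ^ 6 / q) + p * n ^ 4 := by
            field_simp
        _ ≤ 34 * 92160 + 3000000 := by
            have : n ^ 6 / q ≤ 92160 := by rwa [div_le_iff₀ hq0]
            linarith
    rw [le_div_iff₀ (by positivity)]
    refine le_of_mul_le_mul_left ?_ hp0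
    calc p * ((2 * J + n + l) * (128 * n ^ 4))
        = 128 * (2 * (p * n ^ 4 * J) + p * n ^ 5 + p * n ^ 4 * l) := by ring
      _ ≤ 128 * (2 * (34 * 92160 + 3000000) + 3000000 + 3000000 * l) := by
          have := mul_le_mul_of_nonneg_right h9 hl
          linarith
      _ ≤ 2000000000 * (1 + l) := by linarith
      _ ≤ _ := hM
      _ = p * (M * ρ) := by rw [← hpp]; ring

theorem measureReal_le_exp_neg {X : Type*} [MeasurableSpace X] {μ : Measure X} {r : X → ℝ}
    (hre : Integrable (fun x => Real.exp (r x)) μ)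
    (hre4 : ∫ x, Real.exp (r x) ∂μ ≤ 4) (t : ℝ) :
    μ.real {x | t ≤ r x} ≤ 4 * Real.exp (-t) := by
  have h := mul_meas_ge_le_integral_of_nonneg
    (Filter.Eventually.of_forall fun x => (Real.exp_pos (r x)).le) hre (Real.exp t)
  simp only [Real.exp_le_exp] at h
  rw [Real.exp_neg, ← div_eq_mul_inv, le_div_iff₀ (Real.exp_pos t), mul_comm]
  exact h.trans hre4

theorem sq_activation_sub_le {φ : ℝ → ℝ} (hφ : φ ∈ unitActivations) {z F r : ℝ} (hz : |z| ≤ r)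
    (hF : |F| ≤ r) : (φ z - F) ^ 2 ≤ 4 * r ^ 2 := by
  have h1 := abs_sub (φ z) F
  have h2 := abs_le_of_mem_unitActivations hφ z
  calc (φ z - F) ^ 2 = |φ z - F| ^ 2 := (sq_abs _).symm
    _ ≤ (2 * r) ^ 2 := pow_le_pow_left₀ (abs_nonneg _) (by linarith) 2
    _ = _ := by ring

section Uniform

variable {X : Type*} [MeasurableSpace X] {μ : Measure X} [IsProbabilityMeasure μ]

/-- One shell gets error budget ρ / ((k + 1)(k + 2)) and failure probability δ / 2^(k + 1), both
summable over k. Inner shells use the cover; on outer shells the mass is so small that the trivial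
bound 4(k + 1)² on the integrand already fits the budget and failure is impossible. -/
theorem measure_pi_layer {z F r : X → ℝ} (hz : Measurable z) (hF : Measurable F)
    (hr : Measurable r) (hzr : ∀ x, |z x| ≤ r x) (hFr : ∀ x, |F x| ≤ r x)
    (hre : Integrable (fun x => Real.exp (r x)) μ) (hre4 : ∫ x, Real.exp (r x) ∂μ ≤ 4)
    {ρ δ : ℝ} (hρ : 0 < ρ) (hδ : 0 < δ) (hδ1 : δ < 1) {m : ℕ} (hm : 0 < m)
    (hM : 2000000000 * (1 + Real.log (1 / δ)) ≤ m * √ρ ^ 3) (k : ℕ) :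
    Measure.pi (fun _ : Fin m => μ) {S | ∃ φ ∈ unitActivations,
      2 * empMean S ((r ⁻¹' Set.Ico (k : ℝ) (k + 1)).indicator fun x => (φ (z x) - F x) ^ 2) +
        ρ / ((k + 1) * (k + 2)) < ∫ x in r ⁻¹' Set.Ico (k : ℝ) (k + 1), (φ (z x) - F x) ^ 2 ∂μ} ≤
      ENNReal.ofReal (δ * (1 / 2) ^ (k + 1)) := by
  set A := r ⁻¹' Set.Ico (k : ℝ) (k + 1) with hAdef
  have hA : MeasurableSet A := hr measurableSet_Ico
  have hl : 0 ≤ Real.log (1 / δ) := Real.log_nonneg (by rw [le_div_iff₀ hδ]; linarith)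
  have hμA : μ.real A ≤ 4 * Real.exp (-k) :=
    (measureReal_mono fun x hx => hx.1).trans (measureReal_le_exp_neg hre hre4 k)
  have hμA0 : 0 ≤ μ.real A := measureReal_nonneg
  have hrA : ∀ x ∈ A, r x ≤ k + 1 := fun x hx => hx.2.le
  set n : ℝ := (k : ℝ) + 1 with hn
  have hn1 : 1 ≤ n := by simp [hn]
  have hρk : ρ / (2 * n ^ 2) ≤ ρ / (n * (k + 2)) := by
    refine div_le_div_of_nonneg_left hρ.le (by positivity) ?_
    rw [show (k : ℝ) + 2 = n + 1 by rw [hn]; ring]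
    nlinarith
  have hemp : ∀ (S : Fin m → X) (φ : ℝ → ℝ),
      0 ≤ empMean S (A.indicator fun x => (φ (z x) - F x) ^ 2) := fun S φ =>
    mul_nonneg (by positivity) (Finset.sum_nonneg fun i _ =>
      Set.indicator_nonneg (fun x _ => sq_nonneg _) _)
  by_cases hk : ρ < 32 * n ^ 4 * Real.exp (-k)
  · obtain ⟨s, J, hs, hJ, hs2, hE⟩ := exists_grid_of_large_sample hρ hl hk hM
    refine (measure_mono ?_).trans ((measure_pi_setIntegral_sq_lower hz hF hA
      (by positivity : 0 < n) (fun x hx => (hzr x).trans (hrA x hx))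
      (fun x hx => (hFr x).trans (hrA x hx)) hs hJ hm (ρ / (8 * n ^ 2))).trans
      (ENNReal.ofReal_le_ofReal ?_))
    · rintro S ⟨φ, hφ, hS⟩
      refine ⟨φ, hφ, ?_⟩
      have h1 : s ^ 2 * μ.real A ≤ s ^ 2 * (4 * Real.exp (-k)) :=
        mul_le_mul_of_nonneg_left hμA (sq_nonneg s)
      have h2 : ρ / (4 * n ^ 2) = ρ / (2 * n ^ 2) / 2 := by
        field_simp
        norm_num
      have h3 : ρ / (8 * n ^ 2) = ρ / (2 * n ^ 2) / 4 := by
        field_simp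
        norm_num
      rw [h2] at hs2
      rw [h3]
      have := hemp S φ
      nlinarith
    · have e1 : (4 : ℝ) ^ J ≤ Real.exp (2 * J) := by
        rw [mul_comm, Real.exp_nat_mul]
        refine pow_le_pow_left₀ (by norm_num) ?_ J
        have : Real.exp 2 = Real.exp 1 ^ 2 := by
          rw [← Real.exp_nat_mul]
          norm_num
        nlinarith [Real.exp_one_gt_d9]
      have e2 : δ = Real.exp (-Real.log (1 / δ)) := by
        rw [one_div, Real.log_inv, neg_neg, Real.exp_log hδ]
      have e3 : Real.exp (-n) ≤ (1 / 2) ^ (k + 1) := by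
        rw [show -n = ((k + 1 : ℕ) : ℝ) * (-1) by rw [hn]; push_cast; ring, Real.exp_nat_mul]
        refine pow_le_pow_left₀ (Real.exp_pos _).le ?_ _
        rw [Real.exp_neg, inv_eq_one_div]
        exact one_div_le_one_div_of_le (by norm_num) (by linarith [Real.exp_one_gt_d9])
      have e4 : m * (ρ / (8 * n ^ 2)) / (16 * n ^ 2) = m * ρ / (128 * n ^ 4) := by
        field_simp
        ring
      rw [e4]
      calc (4 : ℝ) ^ J * Real.exp (-(m * ρ / (128 * n ^ 4)))
          ≤ Real.exp (2 * J) * Real.exp (-(m * ρ / (128 * n ^ 4))) :=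
            mul_le_mul_of_nonneg_right e1 (Real.exp_pos _).le
        _ = Real.exp (2 * J - m * ρ / (128 * n ^ 4)) := by
            rw [← Real.exp_add, sub_eq_add_neg]
        _ ≤ Real.exp (-Real.log (1 / δ) + -n) := Real.exp_le_exp.2 (by linarith)
        _ = δ * Real.exp (-n) := by rw [Real.exp_add, ← e2]
        _ ≤ _ := mul_le_mul_of_nonneg_left e3 hδ.le
  · have hempty : {S : Fin m → X | ∃ φ ∈ unitActivations,
        2 * empMean S (A.indicator fun x => (φ (z x) - F x) ^ 2) +
          ρ / (n * (k + 2)) < ∫ x in A, (φ (z x) - F x) ^ 2 ∂μ} = ∅ := by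
      rw [Set.eq_empty_iff_forall_notMem]
      rintro S ⟨φ, hφ, hS⟩
      have h1 : ∫ x in A, (φ (z x) - F x) ^ 2 ∂μ ≤ 4 * n ^ 2 * μ.real A := by
        refine (Real.le_norm_self _).trans
          (norm_setIntegral_le_of_norm_le_const (measure_lt_top _ _) fun x hx => ?_)
        rw [Real.norm_of_nonneg (sq_nonneg _)]
        exact sq_activation_sub_le hφ ((hzr x).trans (hrA x hx)) ((hFr x).trans (hrA x hx))
      have h2 : 4 * n ^ 2 * μ.real A ≤ 4 * n ^ 2 * (4 * Real.exp (-k)) :=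
        mul_le_mul_of_nonneg_left hμA (by positivity)
      have h3 : 4 * n ^ 2 * (4 * Real.exp (-k)) ≤ ρ / (2 * n ^ 2) := by
        rw [le_div_iff₀ (by positivity)]
        push Not at hk
        linarith
      have := hemp S φ
      linarith
    rw [hempty, measure_empty]
    exact zero_le

/-- Uniformly over the class `unitActivations`, the squared distance to `F` is at most twice its
empirical counterpart, up to an additive error `ρ`. -/
theorem measure_pi_uniform_sq_le {z F r : X → ℝ} (hz : Measurable z) (hF : Measurable F)
    (hr : Measurable r) (hzr : ∀ x, |z x| ≤ r x) (hFr : ∀ x, |F x| ≤ r x)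
    (hre : Integrable (fun x => Real.exp (r x)) μ) (hre4 : ∫ x, Real.exp (r x) ∂μ ≤ 4)
    {ρ δ : ℝ} (hρ : 0 < ρ) (hδ : 0 < δ) (hδ1 : δ < 1) {m : ℕ} (hm : 0 < m)
    (hM : 2000000000 * (1 + Real.log (1 / δ)) ≤ m * √ρ ^ 3) :
    Measure.pi (fun _ : Fin m => μ) {S | ∃ φ ∈ unitActivations,
      2 * empMean S (fun x => (φ (z x) - F x) ^ 2) + ρ < ∫ x, (φ (z x) - F x) ^ 2 ∂μ} ≤
      ENNReal.ofReal δ := by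
  have hr0 : ∀ x, 0 ≤ r x := fun x => (abs_nonneg _).trans (hzr x)
  set A : ℕ → Set X := fun k => r ⁻¹' Set.Ico (k : ℝ) (k + 1) with hAdef
  have hA : ∀ k, MeasurableSet (A k) := fun k => hr measurableSet_Ico
  have hdisj : Pairwise (Function.onFun Disjoint A) := by
    have hfl : ∀ k x, x ∈ A k → k = ⌊r x⌋₊ := fun k x hx =>
      ((Nat.floor_eq_iff (hr0 x)).2 hx).symm
    intro i j hij
    rw [Function.onFun, Set.disjoint_left]
    intro x hi hj
    exact hij ((hfl i x hi).trans (hfl j x hj).symm)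
  have hunion : ⋃ k, A k = Set.univ := by
    rw [Set.eq_univ_iff_forall]
    intro x
    exact Set.mem_iUnion.2 ⟨⌊r x⌋₊, Nat.floor_le (hr0 x), Nat.lt_floor_add_one _⟩
  -- If no shell fails, summing the shell inequalities gives the global one, since the budgets
  -- telescope to ρ.
  refine (measure_mono (t := ⋃ k : ℕ, {S | ∃ φ ∈ unitActivations,
      2 * empMean S ((A k).indicator fun x => (φ (z x) - F x) ^ 2) +
        ρ / ((k + 1) * (k + 2)) < ∫ x in A k, (φ (z x) - F x) ^ 2 ∂μ}) ?_).trans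
    ((measure_iUnion_le _).trans ((ENNReal.tsum_le_tsum fun k =>
      measure_pi_layer hz hF hr hzr hFr hre hre4 hρ hδ hδ1 hm hM k).trans ?_))
  · rintro S ⟨φ, hφ, hS⟩
    by_contra hcon
    simp only [Set.mem_iUnion, Set.mem_ofPred_eq, not_exists, not_and, not_lt] at hcon
    have hφm := (continuous_of_mem_unitActivations hφ).measurable.comp hz
    have hint : Integrable (fun x => (φ (z x) - F x) ^ 2) μ := by
      refine (hre.const_mul 8).mono' ((hφm.sub hF).pow_const 2).aestronglyMeasurable
        (Filter.Eventually.of_forall fun x => ?_)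
      rw [Real.norm_of_nonneg (sq_nonneg _)]
      have h1 := sq_activation_sub_le hφ (hzr x) (hFr x)
      have h2 := Real.quadratic_le_exp_of_nonneg (hr0 x)
      nlinarith [hr0 x]
    have hsum := hasSum_integral_iUnion (μ := μ) hA hdisj (by rw [hunion]; exact hint.integrableOn)
    rw [hunion, setIntegral_univ] at hsum
    -- The integral is the limit of its sums over finitely many shells, so it suffices to bound
    -- those.
    refine absurd hS (not_lt.2 (le_of_tendsto' hsum.tendsto_sum_nat fun K => ?_))
    have hρsum : ∑ k ∈ Finset.range K, ρ / (((k : ℝ) + 1) * (k + 2)) = ρ * (1 - 1 / (K + 1)) := by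
      induction K with
      | zero => simp
      | succ K ih =>
        rw [Finset.sum_range_succ, ih]
        push_cast
        field_simp
        ring
    have hemp : ∑ k ∈ Finset.range K, empMean S ((A k).indicator fun x => (φ (z x) - F x) ^ 2) ≤
        empMean S (fun x => (φ (z x) - F x) ^ 2) := by
      unfold empMean
      rw [← Finset.mul_sum, Finset.sum_comm]
      refine mul_le_mul_of_nonneg_left (Finset.sum_le_sum fun i _ => ?_) (by positivity)
      rw [← Finset.indicator_biUnion_apply (Finset.range K) A fun a _ b _ hab => hdisj hab]
      exact Set.indicator_le_self' (fun x _ => sq_nonneg _) _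
    calc ∑ k ∈ Finset.range K, ∫ x in A k, (φ (z x) - F x) ^ 2 ∂μ
        ≤ ∑ k ∈ Finset.range K,
          (2 * empMean S ((A k).indicator fun x => (φ (z x) - F x) ^ 2) +
            ρ / (((k : ℝ) + 1) * (k + 2))) := Finset.sum_le_sum fun k _ => hcon k φ hφ
      _ ≤ 2 * empMean S (fun x => (φ (z x) - F x) ^ 2) + ρ := by
          rw [Finset.sum_add_distrib, ← Finset.mul_sum, hρsum]
          have : 0 ≤ ρ * (1 / ((K : ℝ) + 1)) := by positivity
          linarith
  · rw [← ENNReal.ofReal_tsum_of_nonneg (fun k => by positivity)]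
    · refine ENNReal.ofReal_le_ofReal (le_of_eq ?_)
      rw [tsum_mul_left]
      simp_rw [pow_succ]
      rw [tsum_mul_right, tsum_geometric_two]
      norm_num
    · simp_rw [pow_succ]
      exact (summable_geometric_two.mul_right _).mul_left _

end Uniform

/-! ### Upper tail for one function with exponential envelope -/

section Single

variable {X : Type*} [MeasurableSpace X] {μ : Measure X} [IsProbabilityMeasure μ]

/-- Truncation bites only where r > T ≥ β. There Z ≤ 8r² ≤ 64·exp(r/2) ≤ 64·exp(-T/2)·exp(r). -/
theorem posPart_sub_le_exp {Z β r T : ℝ} (hr : 0 ≤ r) (hβ : 0 ≤ β) (hβT : β ≤ T)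
    (h : Z ≤ (β + r) ^ 2 + 4 * r ^ 2) :
    Z - min Z (8 * T ^ 2) ≤ 64 * Real.exp (-(T / 2)) * Real.exp r := by
  have hpos : 0 ≤ 64 * Real.exp (-(T / 2)) * Real.exp r := by positivity
  rcases le_total r T with hrT | hrT
  · have : Z ≤ 8 * T ^ 2 := by nlinarith
    rw [min_eq_left this, sub_self]
    exact hpos
  · rcases le_total Z (8 * T ^ 2) with hZ | hZ
    · rw [min_eq_left hZ, sub_self]
      exact hpos
    · rw [min_eq_right hZ]
      have h1 : Z ≤ 8 * r ^ 2 := by nlinarith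
      have h2 := Real.quadratic_le_exp_of_nonneg (x := r / 2) (by positivity)
      have h3 : Real.exp (r / 2) ≤ Real.exp (-(T / 2)) * Real.exp r := by
        rw [← Real.exp_add]
        exact Real.exp_le_exp.2 (by linarith)
      nlinarith [sq_nonneg T]

/-- Makes T²√ρ bounded, up to (1 + log(1/δ))², for the truncation level T ≈ log(1/ρ), so the squared
logarithm is absorbed in ρ^(-3/2). -/
theorem log_inv_le_four_div {ρ : ℝ} (hρ : 0 < ρ) : Real.log (1 / ρ) ≤ 4 / √(√ρ) := by
  set v := √(√ρ)
  have hv : 0 < v := Real.sqrt_pos.2 (Real.sqrt_pos.2 hρ)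
  have h4 : v ^ 4 = ρ := by
    calc v ^ 4 = (v ^ 2) ^ 2 := by ring
      _ = ρ := by rw [Real.sq_sqrt (Real.sqrt_nonneg _), Real.sq_sqrt hρ.le]
  have h1 := Real.log_le_sub_one_of_pos (x := 1 / v) (by positivity)
  have h2 : Real.log (1 / ρ) = 4 * Real.log (1 / v) := by
    rw [← h4, one_div, one_div, Real.log_inv, Real.log_inv, Real.log_pow]
    push_cast
    ring
  rw [h2, show 4 / v = 4 * (1 / v) by ring]
  linarith

/-- Upper tail bound for the empirical mean of a single function with sub-exponential square
root. -/
theorem measure_pi_empMean_upper_of_exp {Z r : X → ℝ} (hZ : Measurable Z) (hZ0 : ∀ x, 0 ≤ Z x)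
    (hZi : Integrable Z μ) (hr0 : ∀ x, 0 ≤ r x)
    (hre : Integrable (fun x => Real.exp (r x)) μ) (hre4 : ∫ x, Real.exp (r x) ∂μ ≤ 4)
    {ρ δ β : ℝ} (hρ : 0 < ρ) (hρ1 : ρ ≤ 1) (hδ : 0 < δ) (hδ1 : δ < 1) (hβ0 : 0 ≤ β)
    (hβ : β ≤ Real.log (1 / ρ)) (hZr : ∀ᵐ x ∂μ, Z x ≤ (β + r x) ^ 2 + 4 * r x ^ 2) {m : ℕ}
    (hm : 0 < m) (hM : 15488 * (1 + Real.log (1 / δ)) ^ 3 ≤ m * √ρ ^ 3) :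
    Measure.pi (fun _ : Fin m => μ) {S | 3 / 2 * ∫ x, Z x ∂μ + ρ < empMean S Z} ≤
      ENNReal.ofReal δ := by
  set l := Real.log (1 / δ) with hl_def
  have hl : 0 ≤ l := Real.log_nonneg (by rw [le_div_iff₀ hδ]; linarith)
  have hlρ : 0 ≤ Real.log (1 / ρ) := Real.log_nonneg (by rw [le_div_iff₀ hρ]; linarith)
  -- Chosen so that exp(-T/2) = δρ/1024. The truncated excess then has mean at most δρ/4, and Markov
  -- at threshold ρ/2 costs δ/2; the bounded part is left to Chernoff.
  set T := 2 * (Real.log 1024 + l + Real.log (1 / ρ)) with hT_def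
  have hlog : 0 < Real.log 1024 := Real.log_pos (by norm_num)
  have hlog7 : Real.log 1024 ≤ 7 := by
    rw [show (1024 : ℝ) = 2 ^ 10 by norm_num, Real.log_pow]
    have := Real.log_two_lt_d9
    push_cast
    linarith
  have hT0 : 0 < T := by positivity
  have hβT : β ≤ T := by linarith
  have hexpT : Real.exp (-(T / 2)) = δ * ρ / 1024 := by
    rw [show -(T / 2) = -Real.log 1024 + -l + -Real.log (1 / ρ) by rw [hT_def]; ring,
      Real.exp_add, Real.exp_add, hl_def, ← Real.log_inv, ← Real.log_inv, ← Real.log_inv,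
      Real.exp_log (by positivity), Real.exp_log (by positivity), Real.exp_log (by positivity)]
    field_simp
  set p := √ρ with hp
  have hp0 : 0 < p := Real.sqrt_pos.2 hρ
  have hpp : p ^ 2 = ρ := Real.sq_sqrt hρ.le
  have hT2 : T ^ 2 * p ≤ 484 * (1 + l) ^ 2 := by
    set v := √p with hv
    have hv0 : 0 < v := Real.sqrt_pos.2 hp0
    have hvp : v ^ 2 = p := Real.sq_sqrt hp0.le
    have hv1 : v ≤ 1 := Real.sqrt_le_one.2 (Real.sqrt_le_one.2 hρ1)
    have h1 := log_inv_le_four_div hρ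
    rw [← hp, ← hv, le_div_iff₀ hv0] at h1
    have h2 : T * v ≤ 22 * (1 + l) := by
      have : (Real.log 1024 + l) * v ≤ (7 + l) * 1 :=
        mul_le_mul (by linarith) hv1 hv0.le (by linarith)
      calc T * v = 2 * ((Real.log 1024 + l) * v + Real.log (1 / ρ) * v) := by rw [hT_def]; ring
        _ ≤ 22 * (1 + l) := by linarith
    calc T ^ 2 * p = (T * v) ^ 2 := by rw [← hvp]; ring
      _ ≤ (22 * (1 + l)) ^ 2 := pow_le_pow_left₀ (by positivity) h2 2
      _ = _ := by ring
  let Z₁ : X → ℝ := fun x => min (Z x) (8 * T ^ 2)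
  let Z₂ : X → ℝ := fun x => Z x - min (Z x) (8 * T ^ 2)
  have hZ₁m : Measurable Z₁ := hZ.min measurable_const
  have hZ₁0 : ∀ x, 0 ≤ Z₁ x := fun x => le_min (hZ0 x) (by positivity)
  have hZ₁i : Integrable Z₁ μ := hZi.mono' hZ₁m.aestronglyMeasurable
    (Filter.Eventually.of_forall fun x => by
      rw [Real.norm_of_nonneg (hZ₁0 x)]; exact min_le_left _ _)
  have hZ₂0 : ∀ x, 0 ≤ Z₂ x := fun x => sub_nonneg.2 (min_le_left _ _)
  have hZ₂i : Integrable Z₂ μ := hZi.sub hZ₁i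
  have h₁ : ∫ x, Z₁ x ∂μ ≤ ∫ x, Z x ∂μ := integral_mono hZ₁i hZi fun x => min_le_left _ _
  have h₂ : ∫ x, Z₂ x ∂μ ≤ δ * ρ / 4 := by
    calc ∫ x, Z₂ x ∂μ ≤ ∫ x, 64 * Real.exp (-(T / 2)) * Real.exp (r x) ∂μ :=
          integral_mono_ae hZ₂i (hre.const_mul _) (hZr.mono fun x hx =>
            posPart_sub_le_exp (hr0 x) hβ0 hβT hx)
      _ = 64 * (δ * ρ / 1024) * ∫ x, Real.exp (r x) ∂μ := by rw [integral_const_mul, hexpT]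
      _ ≤ 64 * (δ * ρ / 1024) * 4 := mul_le_mul_of_nonneg_left hre4 (by positivity)
      _ = δ * ρ / 4 := by ring
  have hsub : {S : Fin m → X | 3 / 2 * ∫ x, Z x ∂μ + ρ < empMean S Z} ⊆
      {S | 3 / 2 * ∫ x, Z₁ x ∂μ + ρ / 2 < empMean S Z₁} ∪ {S | ρ / 2 ≤ empMean S Z₂} := by
    intro S hS
    by_contra hcon
    simp only [Set.mem_union, Set.mem_ofPred_eq, not_or, not_lt, not_le] at hcon hS
    have : empMean S Z = empMean S Z₁ + empMean S Z₂ := by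
      simp only [empMean, Z₁, Z₂, ← mul_add, ← Finset.sum_add_distrib, add_sub_cancel]
    linarith [hcon.1, hcon.2]
  have e₁ := measure_pi_empMean_upper (μ := μ) hZ₁m hZ₁0 (by positivity : 0 < 8 * T ^ 2)
    (fun x => min_le_right _ _) hm (ρ / 2)
  have e₂ := measure_pi_le_empMean hZ₂i hZ₂0 hm (by positivity : 0 < ρ / 2)
  have b₁ : Real.exp (-(m * (ρ / 2) / (2 * (8 * T ^ 2)))) ≤ δ / 2 := by
    have hδe : δ / 2 = Real.exp (-l - Real.log 2) := by
      rw [Real.exp_sub, hl_def, ← Real.log_inv, Real.exp_log (by positivity),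
        Real.exp_log (by norm_num)]
      field_simp
    rw [hδe]
    refine Real.exp_le_exp.2 ?_
    have hlog2 : Real.log 2 ≤ 1 := by linarith [Real.log_two_lt_d9]
    have : 1 + l ≤ m * (ρ / 2) / (2 * (8 * T ^ 2)) := by
      rw [le_div_iff₀ (by positivity)]
      refine le_of_mul_le_mul_right ?_ hp0
      calc (1 + l) * (2 * (8 * T ^ 2)) * p = 16 * (1 + l) * (T ^ 2 * p) := by ring
        _ ≤ 16 * (1 + l) * (484 * (1 + l) ^ 2) := mul_le_mul_of_nonneg_left hT2 (by positivity)
        _ = (15488 * (1 + l) ^ 3) / 2 := by ring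
        _ ≤ m * p ^ 3 / 2 := by linarith
        _ = m * (ρ / 2) * p := by rw [← hpp]; ring
    linarith
  have b₂ : (∫ x, Z₂ x ∂μ) / (ρ / 2) ≤ δ / 2 := by
    rw [div_le_iff₀ (by positivity)]
    linarith
  calc _ ≤ _ := measure_mono hsub
    _ ≤ _ := measure_union_le _ _
    _ ≤ ENNReal.ofReal (δ / 2) + ENNReal.ofReal (δ / 2) :=
      add_le_add (e₁.trans (ENNReal.ofReal_le_ofReal b₁)) (e₂.trans (ENNReal.ofReal_le_ofReal b₂))
    _ = ENNReal.ofReal δ := by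
      rw [← ENNReal.ofReal_add (by positivity) (by positivity), add_halves]

end Single

/-! ### Exponential moments of projections -/

section Moments

theorem integral_exp_neg_mul_abs {c : ℝ} (hc : 0 < c) :
    ∫ t : ℝ, Real.exp (-c * |t|) = 2 / c := by
  rw [integral_comp_abs (f := fun t => Real.exp (-c * t)),
    integral_exp_mul_Ioi (by linarith : -c < 0)]
  simp only [mul_zero, Real.exp_zero]
  field_simp

theorem lintegral_exp_neg_mul_abs {c : ℝ} (hc : 0 < c) :
    ∫⁻ t : ℝ, ENNReal.ofReal (Real.exp (-c * |t|)) = ENNReal.ofReal (2 / c) := by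
  have hi : Integrable fun t : ℝ => Real.exp (-c * |t|) :=
    Integrable.of_integral_ne_zero (by rw [integral_exp_neg_mul_abs hc]; positivity)
  rw [← ofReal_integral_eq_lintegral_ofReal hi
    (Filter.Eventually.of_forall fun t => (Real.exp_pos _).le), integral_exp_neg_mul_abs hc]

theorem lintegral_vec_one (f : ℝ → ENNReal) (hf : Measurable f) :
    ∫⁻ z : Vec 1, f (z 0) = ∫⁻ t : ℝ, f t := by
  have h1 := (PiLp.volume_preserving_ofLp (Fin 1)).lintegral_comp
    (f := fun z : Fin 1 → ℝ => f (z 0)) (by fun_prop)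
  have h2 := (volume_preserving_funUnique (Fin 1) ℝ).lintegral_comp hf
  rw [← h2]
  exact h1

variable {d : ℕ} {μ : Measure (Vec d)} {L R : ℝ}

/-- Half of the exponential decay of the one-dimensional density is spent on the integrand: the
integral is at most (1/L) ∫ exp(-L|t|/2) dt. -/
theorem WellBehaved.lintegral_exp_le (h : WellBehaved L R μ) (hL : 0 < L) {e : Vec d}
    (he : ‖e‖ = 1) :
    ∫⁻ x, ENNReal.ofReal (Real.exp (L / 2 * |⟪e, x⟫|)) ∂μ ≤ ENNReal.ofReal (4 / L ^ 2) := by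
  obtain ⟨γ, hγ, hγ0, hmap, -, hup⟩ := h 1 le_rfl (by norm_num) (fun _ => e)
    ⟨fun _ => he, fun i j hij => absurd (Subsingleton.elim i j) hij⟩
  have hmeas : Measurable fun x : Vec d => (WithLp.toLp 2 (fun _ : Fin 1 => ⟪e, x⟫) : Vec 1) := by
    fun_prop
  have hg : Measurable fun z : Vec 1 => ENNReal.ofReal (Real.exp (L / 2 * |z 0|)) := by
    fun_prop
  calc ∫⁻ x, ENNReal.ofReal (Real.exp (L / 2 * |⟪e, x⟫|)) ∂μ
      = ∫⁻ z : Vec 1, ENNReal.ofReal (Real.exp (L / 2 * |z 0|))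
          ∂(μ.map fun x => (WithLp.toLp 2 (fun _ : Fin 1 => ⟪e, x⟫) : Vec 1)) := by
        rw [lintegral_map hg hmeas]
    _ = ∫⁻ z : Vec 1, ENNReal.ofReal (γ z) * ENNReal.ofReal (Real.exp (L / 2 * |z 0|)) := by
        rw [hmap, lintegral_withDensity_eq_lintegral_mul _ (by fun_prop) hg]
        rfl
    _ ≤ ∫⁻ z : Vec 1, ENNReal.ofReal (1 / L) *
          ENNReal.ofReal (Real.exp (-(L / 2) * |z 0|)) := by
        refine lintegral_mono fun z => ?_
        rw [← ENNReal.ofReal_mul (hγ0 z), ← ENNReal.ofReal_mul (by positivity)]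
        refine ENNReal.ofReal_le_ofReal ?_
        have hn : ‖z‖ = |z 0| := by
          rw [EuclideanSpace.norm_eq]
          simp [Real.sqrt_sq_eq_abs]
        have := mul_le_mul_of_nonneg_right (hup z) (Real.exp_pos (L / 2 * |z 0|)).le
        refine this.trans (le_of_eq ?_)
        rw [mul_assoc, ← Real.exp_add, hn]
        ring_nf
    _ = ENNReal.ofReal (1 / L) * ENNReal.ofReal (2 / (L / 2)) := by
        rw [lintegral_const_mul _ (by fun_prop), lintegral_vec_one
          (fun t => ENNReal.ofReal (Real.exp (-(L / 2) * |t|))) (by fun_prop),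
          lintegral_exp_neg_mul_abs (by positivity)]
    _ = ENNReal.ofReal (4 / L ^ 2) := by
        rw [← ENNReal.ofReal_mul (by positivity)]
        congr 1
        field_simp
        norm_num

theorem WellBehaved.integral_exp_le (h : WellBehaved L R μ) (hL : 0 < L) {e : Vec d}
    (he : ‖e‖ = 1) :
    Integrable (fun x => Real.exp (L / 2 * |⟪e, x⟫|)) μ ∧
      ∫ x, Real.exp (L / 2 * |⟪e, x⟫|) ∂μ ≤ 4 / L ^ 2 := by
  have hle := h.lintegral_exp_le hL he
  have hm : AEStronglyMeasurable (fun x : Vec d => Real.exp (L / 2 * |⟪e, x⟫|)) μ :=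
    (by fun_prop : Measurable fun x : Vec d =>
      Real.exp (L / 2 * |⟪e, x⟫|)).aestronglyMeasurable
  refine ⟨⟨hm, ?_⟩, ?_⟩
  · rw [hasFiniteIntegral_iff_ofReal (Filter.Eventually.of_forall fun x => (Real.exp_pos _).le)]
    exact hle.trans_lt ENNReal.ofReal_lt_top
  · rw [integral_eq_lintegral_of_nonneg_ae
      (Filter.Eventually.of_forall fun x => (Real.exp_pos _).le) hm]
    exact ENNReal.toReal_le_of_le_ofReal (by positivity) hle

theorem WellBehaved.le_two [IsProbabilityMeasure μ] (h : WellBehaved L R μ) (hL : 0 < L)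
    {e : Vec d} (he : ‖e‖ = 1) : L ≤ 2 := by
  obtain ⟨hi, hle⟩ := h.integral_exp_le hL he
  have h1 : ∫ _, (1 : ℝ) ∂μ ≤ ∫ x, Real.exp (L / 2 * |⟪e, x⟫|) ∂μ :=
    integral_mono (integrable_const _) hi fun x => Real.one_le_exp (by positivity)
  simp only [integral_const, probReal_univ, smul_eq_mul, mul_one] at h1
  have h2 := h1.trans hle
  rw [le_div_iff₀ (by positivity)] at h2
  nlinarith

/-- Replaces the bound 4/L² by an absolute constant. The second moment absorbs the dependence on L:
after the AM-GM step the total is at most 1 + 1/8 + 1/2. -/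
theorem WellBehaved.integral_exp_quarter_le [IsProbabilityMeasure μ] (h : WellBehaved L R μ)
    (h2 : SecondMomentLeOne μ) (hL : 0 < L) {v : Vec d} (hv : ‖v‖ ≤ 1) :
    Integrable (fun x => Real.exp (L / 4 * |⟪v, x⟫|)) μ ∧
      ∫ x, Real.exp (L / 4 * |⟪v, x⟫|) ∂μ ≤ 2 := by
  have hmeas : AEStronglyMeasurable (fun x : Vec d => Real.exp (L / 4 * |⟪v, x⟫|)) μ :=
    (by fun_prop : Measurable fun x : Vec d =>
      Real.exp (L / 4 * |⟪v, x⟫|)).aestronglyMeasurable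
  rcases eq_or_ne v 0 with rfl | hv0
  · simp
  have hn : 0 < ‖v‖ := norm_pos_iff.2 hv0
  set e : Vec d := ‖v‖⁻¹ • v with he_def
  have he : ‖e‖ = 1 := by
    rw [he_def, norm_smul, norm_inv, norm_norm, inv_mul_cancel₀ hn.ne']
  have hve : v = ‖v‖ • e := by
    rw [he_def, smul_smul, mul_inv_cancel₀ hn.ne', one_smul]
  obtain ⟨hi, hle⟩ := h.integral_exp_le hL he
  obtain ⟨hi2, hle2⟩ := h2 e
  rw [he, one_pow] at hle2
  have hpt : ∀ x : Vec d, Real.exp (L / 4 * |⟪v, x⟫|) ≤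
      1 + (1 / 8 * ⟪e, x⟫ ^ 2 + L ^ 2 / 8 * Real.exp (L / 2 * |⟪e, x⟫|)) := by
    intro x
    have h1 : |⟪v, x⟫| ≤ |⟪e, x⟫| := by
      rw [hve, real_inner_smul_left, abs_mul, abs_norm]
      exact mul_le_of_le_one_left (abs_nonneg _) hv
    set a := |⟪e, x⟫| with ha
    have ha0 : 0 ≤ a := abs_nonneg _
    have h3 : Real.exp (L / 4 * |⟪v, x⟫|) ≤ Real.exp (L / 4 * a) :=
      Real.exp_le_exp.2 (mul_le_mul_of_nonneg_left h1 (by positivity))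
    have h4 : Real.exp (L / 4 * a) ≤ 1 + L / 4 * a * Real.exp (L / 4 * a) := by
      have h5 := Real.one_sub_le_exp_neg (L / 4 * a)
      have h6 := mul_le_mul_of_nonneg_right h5 (Real.exp_pos (L / 4 * a)).le
      rw [← Real.exp_add, neg_add_cancel, Real.exp_zero] at h6
      linarith
    have h7 : Real.exp (L / 2 * a) = Real.exp (L / 4 * a) ^ 2 := by
      rw [← Real.exp_nat_mul]
      congr 1
      push_cast
      ring
    rw [h7, ← sq_abs ⟪e, x⟫, ← ha]
    -- AM-GM: (L/4)·a·E ≤ a²/8 + L²E²/8 with E = exp(La/4).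
    nlinarith [sq_nonneg (a - L * Real.exp (L / 4 * a))]
  have hadd : Integrable (fun x : Vec d =>
      1 / 8 * ⟪e, x⟫ ^ 2 + L ^ 2 / 8 * Real.exp (L / 2 * |⟪e, x⟫|)) μ :=
    (hi2.const_mul _).add (hi.const_mul _)
  have hub : Integrable (fun x : Vec d =>
      1 + (1 / 8 * ⟪e, x⟫ ^ 2 + L ^ 2 / 8 * Real.exp (L / 2 * |⟪e, x⟫|))) μ :=
    (integrable_const _).add hadd
  have hint : Integrable (fun x => Real.exp (L / 4 * |⟪v, x⟫|)) μ :=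
    hub.mono' hmeas (Filter.Eventually.of_forall fun x => by
      rw [Real.norm_of_nonneg (Real.exp_pos _).le]; exact hpt x)
  refine ⟨hint, (integral_mono hint hub hpt).trans ?_⟩
  rw [integral_add (integrable_const _) hadd,
    integral_add (hi2.const_mul _) (hi.const_mul _), integral_const_mul, integral_const_mul]
  simp only [integral_const, probReal_univ, smul_eq_mul, mul_one]
  have : L ^ 2 / 8 * ∫ x, Real.exp (L / 2 * |⟪e, x⟫|) ∂μ ≤ L ^ 2 / 8 * (4 / L ^ 2) :=
    mul_le_mul_of_nonneg_left hle (by positivity)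
  rw [show L ^ 2 / 8 * (4 / L ^ 2) = 1 / 2 by field_simp; norm_num] at this
  linarith

end Moments

/-! ### The activation class and empirical projection -/

theorem continuous_of_mem_activations {a b : ℝ} {u : ℝ → ℝ} (hb : 0 ≤ b)
    (hu : u ∈ activations a b) : Continuous u :=
  (LipschitzWith.of_dist_le_mul (K := ⟨b, hb⟩) fun x y => by
    rw [Real.dist_eq, Real.dist_eq]
    exact hu.2.2.1 x y).continuous

theorem abs_le_of_mem_activations {a b : ℝ} {u : ℝ → ℝ} (hu : u ∈ activations a b) (t : ℝ) :
    |u t| ≤ b * |t| := by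
  simpa [hu.1] using hu.2.2.1 t 0

theorem convexCombination_mem_activations {a b : ℝ} {u v : ℝ → ℝ} (hu : u ∈ activations a b)
    (hv : v ∈ activations a b) {t : ℝ} (ht0 : 0 ≤ t) (ht1 : t ≤ 1) :
    (fun x => u x + t * (v x - u x)) ∈ activations a b := by
  have ht : 0 ≤ 1 - t := by linarith
  refine ⟨by simp [hu.1, hv.1], fun x y hxy => ?_, fun x y => ?_, fun x y hy hxy => ?_⟩
  · have h1 := mul_le_mul_of_nonneg_left (hu.2.1 hxy) ht
    have h2 := mul_le_mul_of_nonneg_left (hv.2.1 hxy) ht0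
    simp only
    linarith
  · have h1 := mul_le_mul_of_nonneg_left (hu.2.2.1 x y) ht
    have h2 := mul_le_mul_of_nonneg_left (hv.2.2.1 x y) ht0
    calc |u x + t * (v x - u x) - (u y + t * (v y - u y))|
        = |(1 - t) * (u x - u y) + t * (v x - v y)| := by ring_nf
      _ ≤ |(1 - t) * (u x - u y)| + |t * (v x - v y)| := abs_add_le _ _
      _ = (1 - t) * |u x - u y| + t * |v x - v y| := by
          rw [abs_mul, abs_mul, abs_of_nonneg ht, abs_of_nonneg ht0]
      _ ≤ b * |x - y| := by linarith
  · have h1 := mul_le_mul_of_nonneg_left (hu.2.2.2 x y hy hxy) ht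
    have h2 := mul_le_mul_of_nonneg_left (hv.2.2.2 x y hy hxy) ht0
    simp only
    linarith

/-- A sample-optimal activation is an empirical projection of the labels onto a convex class, so
its distance to any target `f` is controlled by those of the labels and of a competitor `v`. -/
theorem IsSampleOptimal.empMean_sq_le {d m : ℕ} {a b : ℝ} {S : Fin m → Vec d × ℝ} {w : Vec d}
    {u v : ℝ → ℝ} (hm : 0 < m) (hu : IsSampleOptimal a b S w u) (hv : v ∈ activations a b)
    (f : Vec d → ℝ) :
    empMean S (fun p => (u ⟪w, p.1⟫ - f p.1) ^ 2) ≤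
      empMean S (fun p => (f p.1 - p.2) ^ 2 + (v ⟪w, p.1⟫ - f p.1) ^ 2) := by
  set A : Fin m → ℝ := fun i => u ⟪w, (S i).1⟫ - (S i).2
  set K : Fin m → ℝ := fun i => v ⟪w, (S i).1⟫ - u ⟪w, (S i).1⟫
  have hm' : (0 : ℝ) < m := by exact_mod_cast hm
  -- Optimality against the segment from `u` to `v`, with one factor t divided out.
  have hvar : ∀ t : ℝ, 0 < t → t ≤ 1 → 0 ≤ 2 * ∑ i, A i * K i + t * ∑ i, K i ^ 2 := by
    intro t ht0 ht1
    have h := hu.2 _ (convexCombination_mem_activations hu.1 hv ht0.le ht1)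
    unfold empLoss at h
    have h := le_of_mul_le_mul_left h (by positivity)
    have e : ∑ i, (u ⟪w, (S i).1⟫ + t * (v ⟪w, (S i).1⟫ - u ⟪w, (S i).1⟫) - (S i).2) ^ 2 =
        ∑ i, A i ^ 2 + t * (2 * ∑ i, A i * K i + t * ∑ i, K i ^ 2) := by
      simp only [Finset.mul_sum, ← Finset.sum_add_distrib]
      refine Finset.sum_congr rfl fun i _ => ?_
      simp only [A, K]
      ring
    rw [e] at h
    exact nonneg_of_mul_nonneg_right (by linarith) ht0
  have hAK : 0 ≤ ∑ i, A i * K i := by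
    by_contra hneg
    push Not at hneg
    have hK : 0 ≤ ∑ i, K i ^ 2 := Finset.sum_nonneg fun i _ => sq_nonneg _
    set Q := ∑ i, K i ^ 2
    set P := ∑ i, A i * K i
    -- A step this short keeps the quadratic term at most -P, so 2P + tQ ≤ P < 0, a contradiction.
    have h1 := hvar (min 1 (-P / (Q + 1))) (lt_min one_pos (by apply div_pos <;> linarith))
      (min_le_left _ _)
    have h2 : min 1 (-P / (Q + 1)) * Q ≤ -P / (Q + 1) * Q :=
      mul_le_mul_of_nonneg_right (min_le_right _ _) hK
    have h3 : -P / (Q + 1) * Q ≤ -P := by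
      rw [div_mul_eq_mul_div, div_le_iff₀ (by linarith)]
      nlinarith
    linarith
  refine mul_le_mul_of_nonneg_left ?_ (by positivity)
  -- With h = u - f, g = y - f, k = v - f, the gap in each summand is exactly (h - g - k)².
  have key : ∑ i, (u ⟪w, (S i).1⟫ - f (S i).1) ^ 2 + 2 * ∑ i, A i * K i ≤
      ∑ i, ((f (S i).1 - (S i).2) ^ 2 + (v ⟪w, (S i).1⟫ - f (S i).1) ^ 2) := by
    rw [Finset.mul_sum, ← Finset.sum_add_distrib]
    refine Finset.sum_le_sum fun i _ => ?_
    simp only [A, K]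
    nlinarith [sq_nonneg (u ⟪w, (S i).1⟫ - f (S i).1 - ((S i).2 - f (S i).1) -
      (v ⟪w, (S i).1⟫ - f (S i).1))]
  linarith

theorem rescale_mem_unitActivations {a b α c : ℝ} {u : ℝ → ℝ} (hu : u ∈ activations a b)
    (hα : 0 ≤ α) (hc : 0 ≤ c) (h : c * b * α = 1) :
    (fun t => c * u (α * t)) ∈ unitActivations := by
  refine ⟨by simp [hu.1], fun x y hxy =>
    mul_le_mul_of_nonneg_left (hu.2.1 (mul_le_mul_of_nonneg_left hxy hα)) hc, fun x y => ?_⟩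
  calc |c * u (α * x) - c * u (α * y)| = c * |u (α * x) - u (α * y)| := by
        rw [← mul_sub, abs_mul, abs_of_nonneg hc]
    _ ≤ c * (b * |α * x - α * y|) := mul_le_mul_of_nonneg_left (hu.2.2.1 _ _) hc
    _ = c * b * α * |x - y| := by
        rw [← mul_sub, abs_mul, abs_of_nonneg hα]
        ring
    _ = |x - y| := by rw [h, one_mul]

/-! ### Translation of the parameters -/

/-- The base of the 3/2 power equals W/(16ρ), hence is at least 1/(16ρ). The condition d ≥ 2εδ keeps
the logarithm above log 2, so it dominates constants as well as log(1/δ). -/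
theorem sample_size_bound {d m : ℕ} {b L W ε δ ρ : ℝ} (hb : 0 < b) (hL : 0 < L) (hW : 1 ≤ W)
    (hε : 0 < ε) (hε1 : ε < 1) (hδ : 0 < δ) (hd : 2 * (ε * δ) ≤ (d : ℝ)) (hd1 : 1 ≤ (d : ℝ))
    (hδ1 : δ < 1) (hρ : ρ = (L / (4 * b * W)) ^ 2 * ε)
    (hm : 20000000000000 * (d * Real.log (d / (ε * δ)) ^ 4 *
      (b ^ 2 * W ^ 3 / (L ^ 2 * ε)) ^ (3 / 2 : ℝ)) ≤ (m : ℝ)) :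
    0 < m ∧ 2000000000 * (1 + Real.log (1 / (δ / 2))) ^ 3 ≤ m * √ρ ^ 3 := by
  set Λ := Real.log (d / (ε * δ)) with hΛ
  have hεδ : 0 < ε * δ := mul_pos hε hδ
  have hlog2 := Real.log_two_gt_d9
  have hΛ2 : Real.log 2 ≤ Λ :=
    Real.log_le_log (by norm_num) (by rwa [le_div_iff₀ hεδ])
  have hΛδ : Real.log (1 / δ) ≤ Λ := by
    refine Real.log_le_log (by positivity) ?_
    rw [div_le_div_iff₀ hδ hεδ, one_mul]
    nlinarith
  have hl0 : 0 ≤ Real.log (1 / δ) := Real.log_nonneg (by rw [le_div_iff₀ hδ]; linarith)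
  have hl : Real.log (1 / (δ / 2)) = Real.log (1 / δ) + Real.log 2 := by
    rw [← Real.log_mul (by positivity) (by norm_num)]
    congr 1
    field_simp
  have hW0 : 0 < W := by linarith
  have hρ0 : 0 < ρ := by rw [hρ]; positivity
  have hp0 : 0 < √ρ := Real.sqrt_pos.2 hρ0
  have hκ : 1 / (64 * √ρ ^ 3) ≤ (b ^ 2 * W ^ 3 / (L ^ 2 * ε)) ^ (3 / 2 : ℝ) := by
    have h1 : 1 / (16 * ρ) ≤ b ^ 2 * W ^ 3 / (L ^ 2 * ε) := by
      have : b ^ 2 * W ^ 3 / (L ^ 2 * ε) = W * (1 / (16 * ρ)) := by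
        rw [hρ]
        field_simp
        norm_num
      rw [this]
      exact le_mul_of_one_le_left (by positivity) hW
    have h2 : 1 / (64 * √ρ ^ 3) = (1 / (16 * ρ)) ^ (3 / 2 : ℝ) := by
      rw [Real.rpow_div_two_eq_sqrt _ (by positivity), show (3 : ℝ) = ((3 : ℕ) : ℝ) by norm_num,
        Real.rpow_natCast, Real.sqrt_div zero_le_one, Real.sqrt_one,
        Real.sqrt_mul (by norm_num) ρ, show (16 : ℝ) = 4 ^ 2 by norm_num,
        Real.sqrt_sq (by norm_num)]
      ring
    rw [h2]
    exact Real.rpow_le_rpow (by positivity) h1 (by norm_num)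
  have hΛ0 : 0 < Λ := by linarith
  have hmain : 20000000000000 * (Λ ^ 4 * (1 / (64 * √ρ ^ 3))) ≤ (m : ℝ) := by
    refine le_trans (mul_le_mul_of_nonneg_left ?_ (by norm_num)) hm
    refine mul_le_mul ?_ hκ (by positivity) (by positivity)
    exact le_mul_of_one_le_left (by positivity) hd1
  constructor
  · have : (0 : ℝ) < m := lt_of_lt_of_le (by positivity) hmain
    exact_mod_cast this
  · have h1 : 1 + Real.log (1 / (δ / 2)) ≤ 4 * Λ := by
      rw [hl]
      linarith
    have h2 : (1 + Real.log (1 / (δ / 2))) ^ 3 ≤ (4 * Λ) ^ 3 :=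
      pow_le_pow_left₀ (by rw [hl]; positivity) h1 3
    have h3 : Λ ^ 3 ≤ 2 * Λ ^ 4 := by
      have : 0 < Λ ^ 3 := by positivity
      nlinarith
    have h4 := mul_le_mul_of_nonneg_right hmain (pow_pos hp0 3).le
    have h5 : 20000000000000 * (Λ ^ 4 * (1 / (64 * √ρ ^ 3))) * √ρ ^ 3 =
        312500000000 * Λ ^ 4 := by
      field_simp
      norm_num
    rw [h5] at h4
    have h6 : (4 * Λ) ^ 3 = 64 * Λ ^ 3 := by ring
    have h7 : 0 < Λ ^ 4 := by positivity
    linarith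

/-- The argument of the logarithm is L⁴/(16ρ²), at most 1/ρ² because L ≤ 2. Nonnegativity of the
label bound then forces ρ ≤ 1. -/
theorem log_label_le {b L W ε ρ : ℝ} (hb : 0 < b) (hL : 0 < L) (hL2 : L ≤ 2) (hW : 0 < W)
    (hε : 0 < ε) (hρ : ρ = (L / (4 * b * W)) ^ 2 * ε) (h : 0 ≤ labelBound b W L ε) :
    ρ ≤ 1 ∧ L / (4 * b * W) * labelBound b W L ε ≤ Real.log (1 / ρ) := by
  have hρ0 : 0 < ρ := by rw [hρ]; positivity
  have hL4 : L ^ 4 ≤ 16 := by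
    calc L ^ 4 ≤ 2 ^ 4 := pow_le_pow_left₀ hL.le hL2 4
      _ = 16 := by norm_num
  have harg : 16 * b ^ 4 * W ^ 4 / ε ^ 2 = L ^ 4 / (16 * ρ ^ 2) := by
    rw [hρ]
    field_simp
    norm_num
  have hle : L ^ 4 / (16 * ρ ^ 2) ≤ (1 / ρ) ^ 2 := by
    rw [div_pow, one_pow, div_le_div_iff₀ (by positivity) (by positivity)]
    nlinarith [sq_nonneg ρ]
  have hlog : Real.log (16 * b ^ 4 * W ^ 4 / ε ^ 2) ≤ 2 * Real.log (1 / ρ) := by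
    rw [harg]
    refine (Real.log_le_log (by positivity) hle).trans (le_of_eq ?_)
    rw [Real.log_pow]
    norm_num
  have hlog0 : 0 ≤ Real.log (16 * b ^ 4 * W ^ 4 / ε ^ 2) :=
    nonneg_of_mul_nonneg_right h (by positivity)
  have hρ1 : 0 ≤ Real.log (1 / ρ) := by linarith
  constructor
  · have := (Real.log_nonneg_iff (by positivity)).1 hρ1
    rwa [le_div_iff₀ hρ0, one_mul] at this
  · have : L / (4 * b * W) * labelBound b W L ε =
        Real.log (16 * b ^ 4 * W ^ 4 / ε ^ 2) / 4 := by
      unfold labelBound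
      field_simp
    rw [this]
    linarith

/-! ### Moment estimates under the joint distribution -/

theorem SecondMomentLeOne.integral_sq_activation_sub_le {d : ℕ} {ν : Measure (Vec d)}
    [IsProbabilityMeasure ν] (h : SecondMomentLeOne ν) {a b : ℝ} (hb : 0 ≤ b) {u : ℝ → ℝ}
    (hu : u ∈ activations a b) (w w' : Vec d) :
    Integrable (fun x => (u ⟪w, x⟫ - u ⟪w', x⟫) ^ 2) ν ∧
      ∫ x, (u ⟪w, x⟫ - u ⟪w', x⟫) ^ 2 ∂ν ≤ b ^ 2 * ‖w - w'‖ ^ 2 := by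
  obtain ⟨hi, hle⟩ := h (w - w')
  have hum := (continuous_of_mem_activations hb hu).measurable
  have hpt : ∀ x : Vec d, (u ⟪w, x⟫ - u ⟪w', x⟫) ^ 2 ≤ b ^ 2 * ⟪w - w', x⟫ ^ 2 := fun x => by
    rw [← sq_abs (u _ - _), ← sq_abs ⟪w - w', x⟫, ← mul_pow, inner_sub_left]
    exact pow_le_pow_left₀ (abs_nonneg _) (hu.2.2.1 _ _) 2
  have hint : Integrable (fun x => (u ⟪w, x⟫ - u ⟪w', x⟫) ^ 2) ν :=
    (hi.const_mul (b ^ 2)).mono' (by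
      have h1 : Measurable fun x : Vec d => u ⟪w, x⟫ := hum.comp (by fun_prop)
      have h2 : Measurable fun x : Vec d => u ⟪w', x⟫ := hum.comp (by fun_prop)
      exact ((h1.sub h2).pow_const 2).aestronglyMeasurable)
      (Filter.Eventually.of_forall fun x => by
        rw [Real.norm_of_nonneg (sq_nonneg _)]; exact hpt x)
  refine ⟨hint, (integral_mono hint (hi.const_mul _) hpt).trans ?_⟩
  rw [integral_const_mul]
  exact mul_le_mul_of_nonneg_left hle (sq_nonneg b)

theorem SecondMomentLeOne.integrable_sq_residual {d : ℕ} {D : Measure (Vec d × ℝ)}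
    [IsProbabilityMeasure D] (h : SecondMomentLeOne (D.map Prod.fst)) {a b : ℝ} (hb : 0 ≤ b)
    {u : ℝ → ℝ} (hu : u ∈ activations a b) (w : Vec d) {B : ℝ} (hB : ∀ᵐ p ∂D, |p.2| ≤ B) :
    Integrable (fun p : Vec d × ℝ => (u ⟪w, p.1⟫ - p.2) ^ 2) D := by
  have hi : Integrable (fun p : Vec d × ℝ => ⟪w, p.1⟫ ^ 2) D :=
    (h w).1.comp_measurable measurable_fst
  have hum := (continuous_of_mem_activations hb hu).measurable
  have h1 : Measurable fun p : Vec d × ℝ => u ⟪w, p.1⟫ := hum.comp (by fun_prop)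
  refine ((hi.const_mul (2 * b ^ 2)).add (integrable_const (2 * B ^ 2))).mono'
    ((h1.sub measurable_snd).pow_const 2).aestronglyMeasurable (hB.mono fun p hp => ?_)
  rw [Real.norm_of_nonneg (sq_nonneg _)]
  have h2 : u ⟪w, p.1⟫ ^ 2 ≤ b ^ 2 * ⟪w, p.1⟫ ^ 2 := by
    rw [← sq_abs (u _), ← sq_abs ⟪w, p.1⟫, ← mul_pow]
    exact pow_le_pow_left₀ (abs_nonneg _) (abs_le_of_mem_activations hu _) 2
  have h3 : p.2 ^ 2 ≤ B ^ 2 := by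
    rw [← sq_abs p.2]
    exact pow_le_pow_left₀ (abs_nonneg _) hp 2
  simp only [Pi.add_apply]
  nlinarith [sq_nonneg (u ⟪w, p.1⟫ + p.2)]

theorem WellBehaved.integral_exp_max_le {d : ℕ} {D : Measure (Vec d × ℝ)}
    [IsProbabilityMeasure D] {L R : ℝ} (h : WellBehaved L R (D.map Prod.fst))
    (h2 : SecondMomentLeOne (D.map Prod.fst)) (hL : 0 < L) {v v' : Vec d} (hv : ‖v‖ ≤ 1)
    (hv' : ‖v'‖ ≤ 1) :
    Integrable (fun p => Real.exp (max (L / 4 * |⟪v, p.1⟫|) (L / 4 * |⟪v', p.1⟫|))) D ∧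
      ∫ p, Real.exp (max (L / 4 * |⟪v, p.1⟫|) (L / 4 * |⟪v', p.1⟫|)) ∂D ≤ 4 := by
  have : IsProbabilityMeasure (D.map Prod.fst) :=
    Measure.isProbabilityMeasure_map measurable_fst.aemeasurable
  have key : ∀ v : Vec d, ‖v‖ ≤ 1 → Integrable (fun p : Vec d × ℝ =>
      Real.exp (L / 4 * |⟪v, p.1⟫|)) D ∧ ∫ p, Real.exp (L / 4 * |⟪v, p.1⟫|) ∂D ≤ 2 := by
    intro v hv
    obtain ⟨hi, hle⟩ := h.integral_exp_quarter_le h2 hL hv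
    refine ⟨hi.comp_measurable measurable_fst, ?_⟩
    rwa [integral_map measurable_fst.aemeasurable hi.aestronglyMeasurable] at hle
  obtain ⟨hi, hle⟩ := key v hv
  obtain ⟨hi', hle'⟩ := key v' hv'
  have hpt : ∀ p : Vec d × ℝ, Real.exp (max (L / 4 * |⟪v, p.1⟫|) (L / 4 * |⟪v', p.1⟫|)) ≤
      Real.exp (L / 4 * |⟪v, p.1⟫|) + Real.exp (L / 4 * |⟪v', p.1⟫|) := fun p => by
    rcases max_choice (L / 4 * |⟪v, p.1⟫|) (L / 4 * |⟪v', p.1⟫|) with e | e <;> rw [e]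
    · linarith [Real.exp_pos (L / 4 * |⟪v', p.1⟫|)]
    · linarith [Real.exp_pos (L / 4 * |⟪v, p.1⟫|)]
  have hint : Integrable (fun p : Vec d × ℝ =>
      Real.exp (max (L / 4 * |⟪v, p.1⟫|) (L / 4 * |⟪v', p.1⟫|))) D :=
    (hi.add hi').mono' (by
      exact (by fun_prop : Measurable fun p : Vec d × ℝ => Real.exp (max (L / 4 * |⟪v, p.1⟫|)
        (L / 4 * |⟪v', p.1⟫|))).aestronglyMeasurable)
      (Filter.Eventually.of_forall fun p => by
        rw [Real.norm_of_nonneg (Real.exp_pos _).le]; exact hpt p)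
  refine ⟨hint, (integral_mono hint (hi.add hi') hpt).trans ?_⟩
  refine (integral_add hi hi').trans_le ?_
  linarith

theorem empMean_const_mul {X : Type*} {m : ℕ} (S : Fin m → X) (c : ℝ) (f : X → ℝ) :
    empMean S (fun x => c * f x) = c * empMean S f := by
  simp only [empMean, ← Finset.mul_sum]
  ring

end SIM

/-- Closeness of idealized and attainable activations. The constant `C` is universal, the sample is
drawn from the `m`-fold product of `D`, and the bound holds for every choice of the sample-optimal
activation outside a set of samples of (outer) probability at most `δ`. -/
theorem corollary3p4 :
    ∃ C : ℝ, 0 < C ∧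
      ∀ (d : ℕ) (a b L R W ε δ : ℝ),
        0 < a → a ≤ b → 0 < L → 0 < R → 1 ≤ W →
        0 < ε → ε < 1 → 0 < δ → δ < 1 → 2 * (ε * δ) ≤ (d : ℝ) →
      ∀ (D : Measure (SIM.Vec d × ℝ)) [IsProbabilityMeasure D],
        SIM.WellBehaved L R (D.map Prod.fst) →
        SIM.SecondMomentLeOne (D.map Prod.fst) →
        (∀ᵐ p ∂D, |p.2| ≤ SIM.labelBound b W L ε) →
      ∀ (wstar : SIM.Vec d) (ustar : ℝ → ℝ),
        ‖wstar‖ ≤ W → ustar ∈ SIM.activations a b →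
        SIM.popLoss D wstar ustar = SIM.opt D a b W →
      ∀ (w : SIM.Vec d), ‖w‖ ≤ W →
      ∀ m : ℕ,
        C * (d * Real.log (d / (ε * δ)) ^ 4 *
          (b ^ 2 * W ^ 3 / (L ^ 2 * ε)) ^ (3 / 2 : ℝ)) ≤ (m : ℝ) →
        Measure.pi (fun _ : Fin m => D)
          {S | ¬ ∀ u : ℝ → ℝ, SIM.IsSampleOptimal a b S w u →
            ∫ x, (u ⟪w, x⟫ - ustar ⟪wstar, x⟫) ^ 2 ∂(D.map Prod.fst) ≤
              3 * (ε + SIM.opt D a b W + b ^ 2 * ‖w - wstar‖ ^ 2)}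
          ≤ ENNReal.ofReal δ := by
  refine ⟨20000000000000, by norm_num, ?_⟩
  intro d a b L R W ε δ ha hab hL _ hW hε hε1 hδ hδ1 hd D _ hwb hsm hlab wstar ustar hwstar
    hustar hopt w hw m hm
  have hb : 0 < b := ha.trans_le hab
  have hW0 : 0 < W := by linarith
  have hd0 : 0 < d := by
    have : (0 : ℝ) < d := lt_of_lt_of_le (by positivity) hd
    exact_mod_cast this
  have hd1 : (1 : ℝ) ≤ d := by exact_mod_cast hd0
  have hprob : IsProbabilityMeasure (D.map Prod.fst) :=
    Measure.isProbabilityMeasure_map measurable_fst.aemeasurable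
  have hL2 : L ≤ 2 := hwb.le_two hL (e := EuclideanSpace.single ⟨0, hd0⟩ (1 : ℝ)) (by simp)
  have hB0 : 0 ≤ SIM.labelBound b W L ε := by
    obtain ⟨p, hp⟩ := hlab.exists
    exact (abs_nonneg _).trans hp
  -- With this scale, c·b·|w·x| = (L/4)·|(w/W)·x|, whose exponential moment is at most 2.
  set c := L / (4 * b * W) with hc_def
  have hc : 0 < c := by positivity
  set ρ := c ^ 2 * ε with hρ_def
  have hρ0 : 0 < ρ := by positivity
  obtain ⟨hρ1, hβ⟩ := SIM.log_label_le hb hL hL2 hW0 hε hρ_def hB0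
  obtain ⟨hm0, hM⟩ := SIM.sample_size_bound hb hL hW hε hε1 hδ hd hd1 hδ1 hρ_def hm
  have hδ2 : 0 < δ / 2 := by linarith
  have hδ21 : δ / 2 < 1 := by linarith
  set v : SIM.Vec d := W⁻¹ • w with hv_def
  set v' : SIM.Vec d := W⁻¹ • wstar with hv'_def
  have hnorm : ∀ x : SIM.Vec d, ‖x‖ ≤ W → ‖W⁻¹ • x‖ ≤ 1 := fun x hx => by
    rw [norm_smul, norm_inv, Real.norm_of_nonneg hW0.le, inv_mul_le_iff₀ hW0, mul_one]
    exact hx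
  let r : SIM.Vec d × ℝ → ℝ := fun p => max (L / 4 * |⟪v, p.1⟫|) (L / 4 * |⟪v', p.1⟫|)
  obtain ⟨hre, hre4⟩ := hwb.integral_exp_max_le hsm hL (hnorm w hw) (hnorm wstar hwstar)
  have hr : Measurable r := by fun_prop
  have hr0 : ∀ p, 0 ≤ r p := fun p => le_max_of_le_left (by positivity)
  have hscale : ∀ (x y : SIM.Vec d), c * (b * |⟪x, y⟫|) = L / 4 * |⟪W⁻¹ • x, y⟫| :=
    fun x y => by
      rw [real_inner_smul_left, abs_mul, abs_of_pos (inv_pos.2 hW0), hc_def]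
      field_simp
  have hur : ∀ u ∈ SIM.activations a b, ∀ x y : SIM.Vec d,
      |c * u ⟪x, y⟫| ≤ L / 4 * |⟪W⁻¹ • x, y⟫| := fun u hu x y => by
    rw [abs_mul, abs_of_pos hc, ← hscale]
    exact mul_le_mul_of_nonneg_left (SIM.abs_le_of_mem_activations hu _) hc.le
  have humeas : ∀ u ∈ SIM.activations a b, ∀ x : SIM.Vec d,
      Measurable fun p : SIM.Vec d × ℝ => u ⟪x, p.1⟫ := fun u hu x =>
    (SIM.continuous_of_mem_activations hb.le hu).measurable.comp (by fun_prop)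
  let z : SIM.Vec d × ℝ → ℝ := fun p => L / 4 * ⟪v, p.1⟫
  let F : SIM.Vec d × ℝ → ℝ := fun p => c * ustar ⟪wstar, p.1⟫
  have hz : Measurable z := by fun_prop
  have hF : Measurable F := (humeas ustar hustar wstar).const_mul c
  have hzr : ∀ p, |z p| ≤ r p := fun p => by
    refine le_max_of_le_left ?_
    rw [abs_mul, abs_of_pos (by positivity : 0 < L / 4)]
  have hFr : ∀ p, |F p| ≤ r p := fun p => le_max_of_le_right (hur ustar hustar wstar p.1)
  have hl2 : 0 ≤ Real.log (1 / (δ / 2)) := Real.log_nonneg (by rw [le_div_iff₀ hδ2]; linarith)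
  have hpow : 1 + Real.log (1 / (δ / 2)) ≤ (1 + Real.log (1 / (δ / 2))) ^ 3 :=
    le_self_pow₀ (by linarith) (by norm_num)
  have hunif := SIM.measure_pi_uniform_sq_le hz hF hr hzr hFr hre hre4 hρ0 hδ2 hδ21 hm0
    (by linarith)
  let Z : SIM.Vec d × ℝ → ℝ := fun p => c ^ 2 * ((ustar ⟪wstar, p.1⟫ - p.2) ^ 2 +
    (ustar ⟪w, p.1⟫ - ustar ⟪wstar, p.1⟫) ^ 2)
  have hZ : Measurable Z :=
    ((((humeas ustar hustar wstar).sub measurable_snd).pow_const 2).add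
      (((humeas ustar hustar w).sub (humeas ustar hustar wstar)).pow_const 2)).const_mul _
  have hZ0 : ∀ p, 0 ≤ Z p := fun p => by positivity
  obtain ⟨hgi, hgle⟩ := hsm.integral_sq_activation_sub_le hb.le hustar w wstar
  rw [integral_map measurable_fst.aemeasurable hgi.aestronglyMeasurable] at hgle
  have hgi' : Integrable (fun p : SIM.Vec d × ℝ =>
      (ustar ⟪w, p.1⟫ - ustar ⟪wstar, p.1⟫) ^ 2) D := hgi.comp_measurable measurable_fst
  have hyi := hsm.integrable_sq_residual hb.le hustar wstar hlab
  have hZi : Integrable Z D := (hyi.add hgi').const_mul _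
  have hZle : ∫ p, Z p ∂D ≤ c ^ 2 * (SIM.opt D a b W + b ^ 2 * ‖w - wstar‖ ^ 2) := by
    have : ∫ p, Z p ∂D = c ^ 2 * (SIM.opt D a b W +
        ∫ p, (ustar ⟪w, p.1⟫ - ustar ⟪wstar, p.1⟫) ^ 2 ∂D) := by
      rw [integral_const_mul, integral_add hyi hgi', ← hopt]
      rfl
    rw [this]
    exact mul_le_mul_of_nonneg_left (by linarith) (sq_nonneg c)
  have hZr : ∀ᵐ p ∂D, Z p ≤ (c * SIM.labelBound b W L ε + r p) ^ 2 + 4 * r p ^ 2 := by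
    refine hlab.mono fun p hp => ?_
    have h1 : |c * p.2| ≤ c * SIM.labelBound b W L ε := by
      rw [abs_mul, abs_of_pos hc]
      exact mul_le_mul_of_nonneg_left hp hc.le
    have h2 : |c * ustar ⟪w, p.1⟫| ≤ r p := le_max_of_le_left (hur ustar hustar w p.1)
    have h3 := hFr p
    have h4 := abs_sub (F p) (c * p.2)
    have h5 := abs_sub (c * ustar ⟪w, p.1⟫) (F p)
    have h6 : (F p - c * p.2) ^ 2 ≤ (c * SIM.labelBound b W L ε + r p) ^ 2 := by
      rw [← sq_abs]
      exact pow_le_pow_left₀ (abs_nonneg _) (by linarith) 2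
    have h7 : (c * ustar ⟪w, p.1⟫ - F p) ^ 2 ≤ (2 * r p) ^ 2 := by
      rw [← sq_abs]
      exact pow_le_pow_left₀ (abs_nonneg _) (by linarith) 2
    calc Z p = (F p - c * p.2) ^ 2 + (c * ustar ⟪w, p.1⟫ - F p) ^ 2 := by
          simp only [Z, F]
          ring
      _ ≤ (c * SIM.labelBound b W L ε + r p) ^ 2 + (2 * r p) ^ 2 := add_le_add h6 h7
      _ = _ := by ring
  have hsingle := SIM.measure_pi_empMean_upper_of_exp hZ hZ0 hZi hr0 hre hre4 hρ0 hρ1 hδ2 hδ21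
    (by positivity : 0 ≤ c * SIM.labelBound b W L ε) hβ hZr hm0
    (le_trans (mul_le_mul_of_nonneg_right (by norm_num) (by positivity)) hM)
  refine (measure_mono ?_).trans ((measure_union_le _ _).trans
    ((add_le_add hunif hsingle).trans_eq ?_))
  · intro S hS
    by_contra hcon
    simp only [Set.mem_union, Set.mem_ofPred_eq, not_or, not_exists, not_and, not_lt] at hcon
    refine hS fun u hu => ?_
    obtain ⟨hcon₁, hcon₂⟩ := hcon
    -- Undoes the scaling of `z`: the argument 4W/L · z is w·x, and the slope is c · b · 4W/L = 1.
    have hφ : (fun t => c * u (4 * W / L * t)) ∈ SIM.unitActivations :=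
      SIM.rescale_mem_unitActivations hu.1 (by positivity) hc.le (by rw [hc_def]; field_simp)
    have hφz : ∀ p, (c * u (4 * W / L * z p) - F p) ^ 2 =
        c ^ 2 * (u ⟪w, p.1⟫ - ustar ⟪wstar, p.1⟫) ^ 2 := fun p => by
      have : 4 * W / L * z p = ⟪w, p.1⟫ := by
        simp only [z, hv_def, real_inner_smul_left]
        field_simp
      rw [this]
      simp only [F]
      ring
    have h1 := hcon₁ _ hφ
    simp only [hφz] at h1
    rw [SIM.empMean_const_mul, integral_const_mul] at h1
    have h2 := hu.empMean_sq_le hm0 hustar fun x => ustar ⟪wstar, x⟫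
    have h3 : SIM.empMean S Z = c ^ 2 * SIM.empMean S (fun p => (ustar ⟪wstar, p.1⟫ - p.2) ^ 2 +
        (ustar ⟪w, p.1⟫ - ustar ⟪wstar, p.1⟫) ^ 2) := SIM.empMean_const_mul S _ _
    have h4 := mul_le_mul_of_nonneg_left h2 (sq_nonneg c)
    have hum := (SIM.continuous_of_mem_activations hb.le hu.1).measurable
    have husm := (SIM.continuous_of_mem_activations hb.le hustar).measurable
    have hm1 : Measurable fun x : SIM.Vec d => u ⟪w, x⟫ := hum.comp (by fun_prop)
    have hm2 : Measurable fun x : SIM.Vec d => ustar ⟪wstar, x⟫ := husm.comp (by fun_prop)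
    have hm3 : Measurable fun x : SIM.Vec d => (u ⟪w, x⟫ - ustar ⟪wstar, x⟫) ^ 2 :=
      (hm1.sub hm2).pow_const 2
    rw [integral_map measurable_fst.aemeasurable hm3.aestronglyMeasurable]
    -- On the good event, c²E(û - f)² ≤ 2·mean(Z) + ρ ≤ 3·E[Z] + 3ρ, with ρ = c²ε.
    refine le_of_mul_le_mul_left ?_ (by positivity : 0 < c ^ 2)
    linarith
  · rw [← ENNReal.ofReal_add hδ2.le hδ2.le, add_halves]
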